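/- A \emph{pattern} $\pi$ of period $n\ge 2$ is a cyclic permutation of $\{1,\dots,n\}$. A map $f$ has a cycle of pattern $\pi$ if there are points $x_1<\dots<x_n$ in its domain with $f(x_i)=x_{\pi(i)}$ for all $i$. The \emph{over-rotation pair} of $\pi$ is $(p,n)$, where $2p$ is the number of $i$ for which $\pi(i)-i$ and $\pi(\pi(i))-\pi(i)$ have different signs; the \emph{over-rotation number} is $\rho(\pi)=p/n$. The over-rotation pair and number of a cycle are those of its pattern. A pattern $\pi$ \emph{forces} a pattern $\theta$ if every continuous map of a compact interval to itself that has a cycle of pattern $\pi$ has a cycle of pattern $\theta$. A pattern $\pi$ is an \emph{over-twist} if it is forcing-minimal among the patterns of its over-rotation number, i.e. if it forces no pattern $\theta\ne\pi$ with $\rho(\theta)=\rho(\pi)$. For a pattern $\pi$ let $f_\pi:[1,n]\to[1,n]$ be the map with $f_\pi(i)=\pi(i)$ for $i=1,\dots,n$ that is affine on each $[i,i+1]$, and let $r_\pi$ be the left endpoint of the over-rotation interval $[r_\pi,\tfrac12]$ forced by $\pi$, the closure of the set of over-rotation numbers of all cycles of $f_\pi$ of period at least $2$. If a pattern $\pi$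 of period at least $2$ is not an over-twist and $r_\pi=\rho(\pi)$, then the over-rotation pair of $\pi$ is not coprime. -/

import Mathlib

noncomputable section

namespace OverRotation

/-- A (cyclic) pattern: a cyclic permutation of `n ≥ 1` linearly ordered points, which are
labelled `0 < 1 < ⋯ < n - 1` from the left to the right. -/
structure Pattern where
  /-- the number `n` of points -/
  period : ℕ
  period_pos : 0 < period
  /-- the permutation of the points, `i ↦ perm i` -/
  perm : Equiv.Perm (Fin period)
  /-- all points form a single cycle -/
  cyclic : perm.IsCycleOn Set.univ

/-- The map `f` has, in the set `S`, a cycle of pattern `π`: points `x 0 < x 1 < ⋯ < x (n - 1)`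
of `S` that `f` permutes in the way `π` prescribes. -/
def Exhibits (f : ℝ → ℝ) (S : Set ℝ) (π : Pattern) : Prop :=
  ∃ x : Fin π.period → ℝ, StrictMono x ∧ (∀ i, x i ∈ S) ∧ ∀ i, f (x i) = x (π.perm i)

/-- `π` forces `θ`: every continuous map of a compact interval to itself that has a cycle of
pattern `π` has a cycle of pattern `θ`. -/
def Forces (π θ : Pattern) : Prop :=
  ∀ (a b : ℝ) (f : ℝ → ℝ), ContinuousOn f (Set.Icc a b) →
    Set.MapsTo f (Set.Icc a b) (Set.Icc a b) →
    Exhibits f (Set.Icc a b) π → Exhibits f (Set.Icc a b) θ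

namespace Pattern

variable (π : Pattern)

/-- The points `i` for which `π(i) - i` and `π(π(i)) - π(i)` have different signs. -/
def signChanges : Finset (Fin π.period) :=
  {i | (i < π.perm i ∧ π.perm (π.perm i) < π.perm i) ∨
       (π.perm i < i ∧ π.perm i < π.perm (π.perm i))}

/-- The over-rotation pair `(p, q)`: `2 p` is the number of sign changes, and `q` is the
period. -/
def overRotationPair : ℕ × ℕ := (π.signChanges.card / 2, π.period)

/-- The over-rotation number `ρ(π) = p / q`. -/
def overRotationNumber : ℝ := (π.overRotationPair.1 : ℝ) / (π.overRotationPair.2 : ℝ)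

/-- The `P`-linear map for the cycle `P = {0, 1, …, n - 1}` of pattern `π`, a map of
`[0, n - 1]` to itself: it equals `π` on `P` and is affine on every `[k, k + 1]`.
(Only its values on `[0, n - 1]` are used.) -/
def linearMap (t : ℝ) : ℝ :=
  let v : ℕ → ℝ := fun k => if h : k < π.period then ((π.perm ⟨k, h⟩ : ℕ) : ℝ) else 0
  v ⌊t⌋₊ + (t - ⌊t⌋₊) * (v (⌊t⌋₊ + 1) - v ⌊t⌋₊)

end Pattern

/-- The over-rotation numbers of all cycles, other than fixed points, of `f` in `S`. -/
def overRotationNumbers (f : ℝ → ℝ) (S : Set ℝ) : Set ℝ :=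
  {r | ∃ θ : Pattern, 2 ≤ θ.period ∧ Exhibits f S θ ∧ θ.overRotationNumber = r}

/-- The over-rotation interval `I_f` of `f` on `S`: the closure of the set of the over-rotation
numbers of its cycles. -/
def overRotationInterval (f : ℝ → ℝ) (S : Set ℝ) : Set ℝ :=
  closure (overRotationNumbers f S)

namespace Pattern

variable (π : Pattern)

/-- The over-rotation interval `I_π` forced by `π`: that of the `P`-linear map, where `P` is a
cycle of pattern `π`. -/
def forcedInterval : Set ℝ :=
  overRotationInterval π.linearMap (Set.Icc 0 ((π.period : ℝ) - 1))

/-- The left endpoint `r_π` of the forced over-rotation interval `I_π = [r_π, 1/2]`. -/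
def leftEndpoint : ℝ := sInf π.forcedInterval

/-- Over-twist patterns: the forcing-minimal ones among the patterns (other than that of a fixed
point) with a given over-rotation number. -/
def IsOverTwist : Prop :=
  2 ≤ π.period ∧ ∀ θ : Pattern, 2 ≤ θ.period →
    θ.overRotationNumber = π.overRotationNumber → Forces π θ → θ = π

/-- The number of sign changes is even, so that the division by two in the over-rotation pair
is exact. -/
theorem two_mul_overRotationPair_fst :
    2 * π.overRotationPair.1 = π.signChanges.card := by
  classical
  suffices h : Even π.signChanges.card from Nat.two_mul_div_two_of_even h
  by_cases hn : 2 ≤ π.period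
  · have hne : ∀ i, π.perm i ≠ i := by
      intro i hi
      have _hnt : Nontrivial (Fin π.period) := Fin.nontrivial_iff_two_le.mpr hn
      obtain ⟨j, hj⟩ := exists_ne i
      obtain ⟨k, hk⟩ := π.cyclic.2 (Set.mem_univ i) (Set.mem_univ j)
      rw [Equiv.Perm.zpow_apply_eq_self_of_apply_eq_self hi] at hk
      exact hj hk.symm
    let R : Finset (Fin π.period) := {i | i < π.perm i}
    let R' : Finset (Fin π.period) := {i | π.perm i < π.perm (π.perm i)}
    have hcard : R'.card = R.card := by
      apply Finset.card_bij (fun i _ => π.perm i)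
      · intro i hi; simpa [R, R'] using hi
      · intro i _ j _ h; exact π.perm.injective h
      · intro j hj
        refine ⟨π.perm.symm j, ?_, by simp⟩
        simpa [R, R'] using hj
    have hS : π.signChanges = (R \ R') ∪ (R' \ R) := by
      ext i
      have h1 := hne i
      have h2 := hne (π.perm i)
      simp only [signChanges, R, R', Finset.mem_filter, Finset.mem_univ, true_and,
        Finset.mem_union, Finset.mem_sdiff, not_lt]
      constructor
      · rintro (⟨a, b⟩ | ⟨a, b⟩)
        · exact Or.inl ⟨a, b.le⟩
        · exact Or.inr ⟨b, a.le⟩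
      · rintro (⟨a, b⟩ | ⟨a, b⟩)
        · exact Or.inl ⟨a, lt_of_le_of_ne b h2⟩
        · exact Or.inr ⟨lt_of_le_of_ne b h1, a⟩
    have hd : Disjoint (R \ R') (R' \ R) :=
      Finset.disjoint_left.mpr fun i hi hj =>
        (Finset.mem_sdiff.mp hi).2 (Finset.mem_sdiff.mp hj).1
    have e1 := Finset.card_sdiff_add_card_inter R R'
    have e2 := Finset.card_sdiff_add_card_inter R' R
    rw [Finset.inter_comm] at e2
    rw [hS, Finset.card_union_of_disjoint hd]
    exact ⟨(R \ R').card, by omega⟩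
  · have : π.signChanges = ∅ := by
      ext i
      have h1 : π.perm i = i := Fin.ext (by omega)
      simp [signChanges, h1]
    simp [this]

end Pattern

end OverRotation

end

namespace OverRotation

open Set

/-! The argument is by contraposition. Let the over-rotation pair (p, n) be coprime and suppose that
no cycle of f = `π.linearMap` has over-rotation number below p/n; then `π` is an over-twist.

Minimality forbids a point moved left directly followed by a point moved right: orbits lingering
next to the repelling fixed point between them would have arbitrarily small over-rotation number
(`IsMinimal.not_divergent`). Hence a fixed point `a` separates the points moved right from those
moved left, and p counts the passages of the cycle from the left of `a` to its right.

Attach to each of the n points the interval between it and its neighbour towards `a` (its `cell`),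
and consider the graph of coverings between cells. Every loop is followed by a periodic point, so
its proportion of crossings is at least p/n (`loop_bound`). By coprimality, equality forces the
length of the loop to be a multiple of n. This is used twice. A closed walk through cells that
follows the cycle itself cannot repeat a cell, which forces each cell to cover the cell of the image
point (`cellCovers_perm`). Then a potential on the cells shows that any other edge is strictly too
expensive for a loop of proportion p/n (`exists_strict_potential`).

So a cycle of f with number p/n visits the cells exactly as `π` prescribes. As f is affine on cells,
n steps multiply the distance to the outer end of the cell by a constant. Periodicity makes this
constant 1 or the distance 0, so the cycle closes after n steps, with one point in each cell, and
its pattern is `π` (`eq_of_exhibits`). -/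

/-! ### Interval coverings and periodic points. -/

theorem exists_Icc_image_eq_of_endpoints {φ : ℝ → ℝ} {s t c d : ℝ} (hst : s ≤ t) (hcd : c ≤ d)
    (hφ : ContinuousOn φ (Icc s t)) (hs : φ s = c) (ht : φ t = d) :
    ∃ u v, u ≤ v ∧ Icc u v ⊆ Icc s t ∧ φ '' Icc u v = Icc c d := by
  have hA : IsCompact (Icc s t ∩ φ ⁻¹' Iic c) :=
    isCompact_Icc.of_isClosed_subset (hφ.preimage_isClosed_of_isClosed isClosed_Icc isClosed_Iic)
      inter_subset_left
  -- `u` is the last point with value at most `c`, and `v` below is the first point after it with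
  -- value at least `d`; between the two no value can leave [c, d].
  obtain ⟨u, ⟨hu, huc⟩, humax⟩ := hA.exists_isGreatest ⟨s, left_mem_Icc.2 hst, hs.le⟩
  have hφ' : ContinuousOn φ (Icc u t) := hφ.mono (Icc_subset_Icc_left hu.1)
  have hB : IsCompact (Icc u t ∩ φ ⁻¹' Ici d) :=
    isCompact_Icc.of_isClosed_subset (hφ'.preimage_isClosed_of_isClosed isClosed_Icc isClosed_Ici)
      inter_subset_left
  obtain ⟨v, ⟨hv, hvd⟩, hvmin⟩ := hB.exists_isLeast ⟨t, right_mem_Icc.2 hu.2, ht.ge⟩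
  have huc' : φ u ≤ c := huc
  have hvd' : d ≤ φ v := hvd
  have hφ'' : ContinuousOn φ (Icc u v) := hφ'.mono (Icc_subset_Icc_right hv.2)
  have hue : φ u = c := by
    obtain ⟨r, hr, hrc⟩ := intermediate_value_Icc hu.2 hφ' ⟨huc', by rw [ht]; exact hcd⟩
    have : r ≤ u := humax ⟨⟨hu.1.trans hr.1, hr.2⟩, hrc.le⟩
    rw [← le_antisymm this hr.1]; exact hrc
  have hve : φ v = d := by
    obtain ⟨r, hr, hrc⟩ := intermediate_value_Icc hv.1 hφ'' ⟨by rw [hue]; exact hcd, hvd'⟩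
    have : v ≤ r := hvmin ⟨⟨hr.1, hr.2.trans hv.2⟩, hrc.ge⟩
    rw [le_antisymm this hr.2]; exact hrc
  refine ⟨u, v, hv.1, Icc_subset_Icc hu.1 hv.2, Subset.antisymm ?_ ?_⟩
  · rintro _ ⟨r, hr, rfl⟩
    constructor
    · by_contra! h
      have : r ≤ u := humax ⟨⟨hu.1.trans hr.1, hr.2.trans hv.2⟩, h.le⟩
      rw [le_antisymm this hr.1, hue] at h
      exact lt_irrefl _ h
    · by_contra! h
      have : v ≤ r := hvmin ⟨⟨hr.1, hr.2.trans hv.2⟩, h.le⟩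
      rw [← le_antisymm this hr.2, hve] at h
      exact lt_irrefl _ h
  · have := intermediate_value_Icc hv.1 hφ''
    rwa [hue, hve] at this

/-- A compact interval covered by the image of a compact interval is the image of a compact
subinterval. -/
theorem exists_Icc_image_eq {φ : ℝ → ℝ} {u v c d : ℝ} (hcd : c ≤ d)
    (hφ : ContinuousOn φ (Icc u v)) (h : Icc c d ⊆ φ '' Icc u v) :
    ∃ u' v', u' ≤ v' ∧ Icc u' v' ⊆ Icc u v ∧ φ '' Icc u' v' = Icc c d := by
  obtain ⟨s, hs, hsc⟩ := h (left_mem_Icc.2 hcd)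
  obtain ⟨t, ht, htd⟩ := h (right_mem_Icc.2 hcd)
  rcases le_total s t with hst | hst
  · have hsub : Icc s t ⊆ Icc u v := Icc_subset_Icc hs.1 ht.2
    obtain ⟨u', v', h1, h2, h3⟩ :=
      exists_Icc_image_eq_of_endpoints hst hcd (hφ.mono hsub) hsc htd
    exact ⟨u', v', h1, h2.trans hsub, h3⟩
  · have hsub : Icc t s ⊆ Icc u v := Icc_subset_Icc ht.1 hs.2
    obtain ⟨u', v', h1, h2, h3⟩ :=
      exists_Icc_image_eq_of_endpoints (φ := fun x => -φ x) hst (neg_le_neg hcd)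
        (hφ.mono hsub).neg (by rw [htd]) (by rw [hsc])
    refine ⟨u', v', h1, h2.trans hsub, ?_⟩
    ext z
    have := Set.ext_iff.1 h3 (-z)
    simpa [and_comm] using this

/-- Every compact subinterval of `B` is the image under `f^[m]` of a compact subinterval of `A`
on which `Q` holds. -/
def Follows (f : ℝ → ℝ) (m : ℕ) (A B : Set ℝ) (Q : ℝ → Prop) : Prop :=
  ∀ c d, c ≤ d → Icc c d ⊆ B → ∃ u v, u ≤ v ∧ Icc u v ⊆ A ∧ ContinuousOn f^[m] (Icc u v) ∧
    f^[m] '' Icc u v = Icc c d ∧ ∀ x ∈ Icc u v, Q x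

theorem Follows.mono {f : ℝ → ℝ} {m : ℕ} {A B : Set ℝ} {Q Q' : ℝ → Prop}
    (h : Follows f m A B Q) (hQ : ∀ x, Q x → Q' x) : Follows f m A B Q' := by
  intro c d hcd hB
  obtain ⟨u, v, h1, h2, h3, h4, h5⟩ := h c d hcd hB
  exact ⟨u, v, h1, h2, h3, h4, fun x hx => hQ x (h5 x hx)⟩

theorem Follows.of_subset_image {f : ℝ → ℝ} {m : ℕ} {u v : ℝ} {B : Set ℝ}
    (hf : ContinuousOn f^[m] (Icc u v)) (h : B ⊆ f^[m] '' Icc u v) :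
    Follows f m (Icc u v) B (· ∈ Icc u v) := by
  intro c d hcd hB
  obtain ⟨u', v', h1, h2, h3⟩ := exists_Icc_image_eq hcd hf (hB.trans h)
  exact ⟨u', v', h1, h2, hf.mono h2, h3, fun x hx => h2 hx⟩

theorem Follows.refl (f : ℝ → ℝ) (A : Set ℝ) : Follows f 0 A A (fun _ => True) := by
  intro c d hcd hA
  exact ⟨c, d, hcd, hA, continuousOn_id, by simp, fun _ _ => trivial⟩

/-- Intervals are pulled back from the end of the chain to its beginning; this is why `Follows`
quantifies over all compact subintervals of the target. -/
theorem Follows.trans {f : ℝ → ℝ} {m m' : ℕ} {A B C : Set ℝ} {Q Q' : ℝ → Prop}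
    (h : Follows f m A B Q) (h' : Follows f m' B C Q') :
    Follows f (m + m') A C (fun x => Q x ∧ Q' (f^[m] x)) := by
  intro c d hcd hC
  obtain ⟨u, v, h1, h2, h3, h4, h5⟩ := h' c d hcd hC
  obtain ⟨s, t, k1, k2, k3, k4, k5⟩ := h u v h1 h2
  have hmaps : ∀ x ∈ Icc s t, f^[m] x ∈ Icc u v := fun x hx => k4 ▸ mem_image_of_mem _ hx
  have hcomp : f^[m + m'] = f^[m'] ∘ f^[m] := by rw [add_comm, Function.iterate_add]
  refine ⟨s, t, k1, k2, ?_, ?_, fun x hx => ⟨k5 x hx, h5 _ (hmaps x hx)⟩⟩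
  · rw [hcomp]; exact h3.comp k3 hmaps
  · rw [hcomp, image_comp, k4, h4]

theorem exists_fixed_of_subset_image {φ : ℝ → ℝ} {u v : ℝ} (huv : u ≤ v)
    (hφ : ContinuousOn φ (Icc u v)) (h : Icc u v ⊆ φ '' Icc u v) : ∃ x ∈ Icc u v, φ x = x := by
  obtain ⟨s, hs, hsu⟩ := h (left_mem_Icc.2 huv)
  obtain ⟨t, ht, htv⟩ := h (right_mem_Icc.2 huv)
  have hsub : uIcc s t ⊆ Icc u v := by
    rw [← uIcc_of_le huv] at hs ht ⊢; exact uIcc_subset_uIcc hs ht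
  have hc : ContinuousOn (fun x => φ x - x) (uIcc s t) := (hφ.mono hsub).sub continuousOn_id
  have h0 : (0 : ℝ) ∈ uIcc (φ s - s) (φ t - t) := by
    rw [mem_uIcc]; left; constructor <;> linarith [hs.1, ht.2]
  obtain ⟨x, hx, hx0⟩ := intermediate_value_uIcc hc h0
  exact ⟨x, hsub hx, by simpa [sub_eq_zero] using hx0⟩

theorem Follows.exists_periodic {f : ℝ → ℝ} {m : ℕ} {u v : ℝ} {Q : ℝ → Prop} (huv : u ≤ v)
    (h : Follows f m (Icc u v) (Icc u v) Q) : ∃ x ∈ Icc u v, f^[m] x = x ∧ Q x := by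
  obtain ⟨s, t, h1, h2, h3, h4, h5⟩ := h u v huv subset_rfl
  obtain ⟨x, hx, hfx⟩ := exists_fixed_of_subset_image h1 h3 (h2.trans h4.ge)
  exact ⟨x, h2 hx, hfx, h5 x hx⟩

/-- A closed chain of intervals, each covering the next one, is followed by a periodic point. -/
theorem exists_periodic_of_covering {f : ℝ → ℝ} {l r : ℕ → ℝ} {L : ℕ}
    (hlr : ∀ i, l i ≤ r i) (hf : ∀ i, ContinuousOn f (Icc (l i) (r i)))
    (hcov : ∀ i < L, Icc (l (i + 1)) (r (i + 1)) ⊆ f '' Icc (l i) (r i))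
    (hl : l L = l 0) (hr : r L = r 0) :
    ∃ x, f^[L] x = x ∧ ∀ i ≤ L, f^[i] x ∈ Icc (l i) (r i) := by
  have key : ∀ m ≤ L, Follows f m (Icc (l 0) (r 0)) (Icc (l m) (r m))
      (fun x => ∀ i < m, f^[i] x ∈ Icc (l i) (r i)) := by
    intro m
    induction m with
    | zero => intro _; exact (Follows.refl f _).mono (by simp)
    | succ m ih =>
      intro hm
      have h1 : Follows f 1 (Icc (l m) (r m)) (Icc (l (m + 1)) (r (m + 1)))
          (· ∈ Icc (l m) (r m)) :=
        Follows.of_subset_image (by simpa using hf m) (by simpa using hcov m (by omega))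
      refine ((ih (by omega)).trans h1).mono ?_
      rintro x ⟨hx1, hx2⟩ i hi
      rcases Nat.lt_succ_iff_lt_or_eq.1 hi with h | rfl
      · exact hx1 i h
      · exact hx2
  have h := key L le_rfl
  rw [hl, hr] at h
  obtain ⟨x, hx0, hx, hQ⟩ := h.exists_periodic (hlr 0)
  refine ⟨x, hx, fun i hi => ?_⟩
  rcases hi.lt_or_eq with h | rfl
  · exact hQ i h
  · rw [hx, hl, hr]; exact hx0

/-! ### Orbits and sign changes of a pattern. -/

namespace Pattern

variable (π : Pattern)

theorem isCycleOn_coe_univ : π.perm.IsCycleOn ((Finset.univ : Finset (Fin π.period)) : Set _) := by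
  simpa using π.cyclic

theorem exists_pow_eq (i j : Fin π.period) : ∃ t < π.period, (π.perm ^ t) i = j := by
  simpa using π.isCycleOn_coe_univ.exists_pow_eq (Finset.mem_univ i) (Finset.mem_univ j)

theorem pow_apply_eq_iff (i : Fin π.period) (t : ℕ) : (π.perm ^ t) i = i ↔ π.period ∣ t := by
  simpa using π.isCycleOn_coe_univ.pow_apply_eq (Finset.mem_univ i) (n := t)

theorem perm_apply_ne (h : 2 ≤ π.period) (i : Fin π.period) : π.perm i ≠ i := by
  intro hi
  have := (π.pow_apply_eq_iff i 1).1 (by simpa using hi)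
  have := Nat.le_of_dvd one_pos this
  omega

theorem pow_apply_inj {i : Fin π.period} {s t : ℕ} (hs : s < π.period) (ht : t < π.period)
    (h : (π.perm ^ s) i = (π.perm ^ t) i) : s = t := by
  wlog hst : s ≤ t generalizing s t
  · exact (this ht hs h.symm (le_of_not_ge hst)).symm
  have h1 : (π.perm ^ (t - s)) i = i := by
    apply (π.perm ^ s).injective
    rw [← Equiv.Perm.mul_apply, ← pow_add, Nat.add_sub_cancel' hst, h]
  have := Nat.eq_zero_of_dvd_of_lt ((π.pow_apply_eq_iff i _).1 h1) (by omega)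
  omega

theorem sum_range_period {M : Type*} [AddCommMonoid M] (g : Fin π.period → M)
    (i : Fin π.period) :
    ∑ s ∈ Finset.range π.period, g ((π.perm ^ s) i) = ∑ j, g j := by
  refine Finset.sum_bij (fun s _ => (π.perm ^ s) i) (fun _ _ => Finset.mem_univ _) ?_ ?_
    (fun _ _ => rfl)
  · intro s hs t ht h
    exact π.pow_apply_inj (Finset.mem_range.1 hs) (Finset.mem_range.1 ht) h
  · intro j _
    obtain ⟨t, ht, h⟩ := π.exists_pow_eq i j
    exact ⟨t, Finset.mem_range.2 ht, h⟩

theorem sum_range_mul_period (g : Fin π.period → ℕ) (i : Fin π.period) (m : ℕ) :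
    ∑ s ∈ Finset.range (π.period * m), g ((π.perm ^ s) i) = m * ∑ j, g j := by
  induction m with
  | zero => simp
  | succ m ih =>
    rw [Nat.mul_succ, Finset.sum_range_add, ih, Nat.succ_mul]
    congr 1
    rw [← π.sum_range_period g ((π.perm ^ (π.period * m)) i)]
    refine Finset.sum_congr rfl fun s _ => ?_
    rw [add_comm, pow_add, Equiv.Perm.mul_apply]

/-- The first entry of the over-rotation pair counts the sign changes from plus to minus. -/
theorem overRotationPair_fst_eq (h2 : 2 ≤ π.period) :
    π.overRotationPair.1 =
      ∑ i, if i < π.perm i ∧ π.perm (π.perm i) < π.perm i then 1 else 0 := by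
  have hsum := π.two_mul_overRotationPair_fst
  set U : ℕ := ∑ i, if i < π.perm i ∧ π.perm (π.perm i) < π.perm i then 1 else 0 with hU
  set D : ℕ := ∑ i, if π.perm i < i ∧ π.perm i < π.perm (π.perm i) then 1 else 0 with hD
  have hcard : π.signChanges.card = U + D := by
    rw [signChanges, Finset.card_filter, hU, hD, ← Finset.sum_add_distrib]
    refine Finset.sum_congr rfl fun i _ => ?_
    by_cases h1 : i < π.perm i
    · simp [h1, h1.not_gt]
    · simp [h1]
  -- The difference compares the indicator of moving right at `i` and at `π.perm i`; both have the
  -- same sum over the cycle.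
  have hUD : (U : ℤ) - D = 0 := by
    have hperm := Equiv.sum_comp π.perm
      (fun i => if i < π.perm i then (1 : ℤ) else 0)
    have hdiff : (U : ℤ) - D = (∑ i, if i < π.perm i then (1 : ℤ) else 0) -
        ∑ i, if π.perm i < π.perm (π.perm i) then (1 : ℤ) else 0 := by
      rw [hU, hD]
      simp only [Nat.cast_sum, Nat.cast_ite, Nat.cast_one, Nat.cast_zero]
      rw [← Finset.sum_sub_distrib, ← Finset.sum_sub_distrib]
      refine Finset.sum_congr rfl fun i _ => ?_
      have n1 := π.perm_apply_ne h2 i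
      have n2 := π.perm_apply_ne h2 (π.perm i)
      rcases lt_or_gt_of_ne n1 with h | h <;> rcases lt_or_gt_of_ne n2 with h' | h' <;>
        simp [h, h', h.not_gt, h'.not_gt]
    rw [hdiff, hperm, sub_self]
  omega

theorem two_mul_overRotationPair_fst_le : 2 * π.overRotationPair.1 ≤ π.period := by
  rw [two_mul_overRotationPair_fst]
  simpa using Finset.card_le_univ π.signChanges

end Pattern

/-! ### From periodic points to patterns. -/

/-- The orbit of a periodic point is a cycle of some pattern. -/
theorem exists_pattern_of_periodic {f : ℝ → ℝ} {S : Set ℝ} (hS : MapsTo f S S) {x : ℝ}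
    (hx : x ∈ S) {L : ℕ} (hL : 0 < L) (hfx : f^[L] x = x) :
    ∃ (θ : Pattern) (y : Fin θ.period → ℝ) (i₀ : Fin θ.period), StrictMono y ∧ (∀ i, y i ∈ S) ∧
      (∀ i, f (y i) = y (θ.perm i)) ∧ y i₀ = x := by
  classical
  let O : Finset ℝ := (Finset.range L).image (fun i => f^[i] x)
  have hxO : x ∈ O := Finset.mem_image.2 ⟨0, Finset.mem_range.2 hL, rfl⟩
  have hfO : ∀ z ∈ O, f z ∈ O := by
    intro z hz
    obtain ⟨i, hi, rfl⟩ := Finset.mem_image.1 hz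
    rw [Finset.mem_range] at hi
    rw [← Function.iterate_succ_apply' f i x]
    rcases (Nat.succ_le_of_lt hi).lt_or_eq with h | h
    · exact Finset.mem_image.2 ⟨i + 1, Finset.mem_range.2 h, rfl⟩
    · rw [show i.succ = L from h, hfx]; exact hxO
  have hOS : ∀ z ∈ O, z ∈ S := by
    intro z hz
    obtain ⟨i, -, rfl⟩ := Finset.mem_image.1 hz
    exact hS.iterate i hx
  let F : O → O := fun z => ⟨f z, hfO z z.2⟩
  have hF : ∀ (i : ℕ) (z : O), ((F^[i] z : O) : ℝ) = f^[i] z := by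
    intro i
    induction i with
    | zero => intro z; rfl
    | succ i ih => intro z; rw [Function.iterate_succ_apply, Function.iterate_succ_apply, ih]
  have hreach : ∀ z : O, ∃ i, F^[i] ⟨x, hxO⟩ = z := by
    intro z
    obtain ⟨i, -, hi⟩ := Finset.mem_image.1 z.2
    exact ⟨i, Subtype.ext (by rw [hF]; exact hi)⟩
  have hsurj : Function.Surjective F := by
    intro z
    obtain ⟨i, hi⟩ := hreach z
    -- Only the base point needs periodicity: its preimage in the orbit is the iterate number `L -
    -- 1`.
    rcases i with _ | i
    · refine ⟨F^[L - 1] ⟨x, hxO⟩, ?_⟩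
      rw [← Function.iterate_succ_apply' F, ← hi]
      apply Subtype.ext
      rw [hF, Nat.succ_eq_add_one, Nat.sub_add_cancel hL]
      exact hfx
    · exact ⟨F^[i] ⟨x, hxO⟩, by rw [← Function.iterate_succ_apply' F, hi]⟩
  let G : Equiv.Perm O := Equiv.ofBijective F (Finite.injective_iff_surjective.2 hsurj |>.bijective_of_finite)
  let e : Fin O.card ≃o O := O.orderIsoOfFin rfl
  let P : Equiv.Perm (Fin O.card) := (e.toEquiv.trans G).trans e.toEquiv.symm
  have hP : ∀ i, e (P i) = F (e i) := by intro i; simp [P, G]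
  have hPi : ∀ (t : ℕ) i, e ((P ^ t) i) = F^[t] (e i) := by
    intro t
    induction t with
    | zero => intro i; rfl
    | succ t ih => intro i; rw [pow_succ, Equiv.Perm.mul_apply, ih, hP, Function.iterate_succ_apply]
  let i₀ : Fin O.card := e.symm ⟨x, hxO⟩
  have hi₀ : e i₀ = ⟨x, hxO⟩ := e.apply_symm_apply _
  have hsame : ∀ i, P.SameCycle i₀ i := by
    intro i
    obtain ⟨t, ht⟩ := hreach (e i)
    refine ⟨t, ?_⟩
    apply e.injective
    rw [zpow_natCast, hPi, hi₀, ht]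
  let θ : Pattern := ⟨O.card, Finset.card_pos.2 ⟨x, hxO⟩, P,
    ⟨P.bijective.bijOn_univ, fun i _ j _ => (hsame i).symm.trans (hsame j)⟩⟩
  refine ⟨θ, fun i => e i, i₀, fun i j hij => ?_, fun i => hOS _ (e i).2, fun i => ?_, ?_⟩
  · exact e.lt_iff_lt.2 hij
  · exact (congrArg Subtype.val (hP i)).symm
  · exact congrArg Subtype.val hi₀

theorem iterate_apply_eq {f : ℝ → ℝ} {θ : Pattern} {y : Fin θ.period → ℝ}
    (hf : ∀ i, f (y i) = y (θ.perm i)) (t : ℕ) (i : Fin θ.period) :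
    f^[t] (y i) = y ((θ.perm ^ t) i) := by
  induction t generalizing i with
  | zero => rfl
  | succ t ih => rw [Function.iterate_succ_apply, hf, ih, pow_succ, Equiv.Perm.mul_apply]

/-- If all cycles of `f` have over-rotation number at least `p / n`, then along the orbit of a
periodic point the proportion of sign changes from plus to minus is at least `p / n`. -/
theorem le_card_sign_changes {f : ℝ → ℝ} {S : Set ℝ} (hS : MapsTo f S S) {p n : ℕ}
    (hmin : ∀ θ : Pattern, 2 ≤ θ.period → Exhibits f S θ →
      p * θ.period ≤ n * θ.overRotationPair.1) {x : ℝ} (hx : x ∈ S) {L : ℕ} (hL : 0 < L)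
    (hfx : f^[L] x = x) (hne : f x ≠ x) :
    p * L ≤ n * ∑ s ∈ Finset.range L,
      if f^[s] x < f^[s + 1] x ∧ f^[s + 2] x < f^[s + 1] x then 1 else 0 := by
  obtain ⟨θ, y, i₀, hy, hyS, hf, rfl⟩ := exists_pattern_of_periodic hS hx hL hfx
  have h2 : 2 ≤ θ.period := by
    by_contra! h
    have : θ.perm i₀ = i₀ := Fin.ext (by omega)
    exact hne (by rw [hf, this])
  have hit := iterate_apply_eq hf
  have hLq : θ.period ∣ L := by
    rw [← θ.pow_apply_eq_iff i₀]
    apply hy.injective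
    rw [← hit, hfx]
  obtain ⟨m, rfl⟩ := hLq
  have hsum : ∑ s ∈ Finset.range (θ.period * m),
      (if f^[s] (y i₀) < f^[s + 1] (y i₀) ∧ f^[s + 2] (y i₀) < f^[s + 1] (y i₀) then 1 else 0)
      = m * θ.overRotationPair.1 := by
    rw [θ.overRotationPair_fst_eq h2, ← θ.sum_range_mul_period _ i₀ m]
    refine Finset.sum_congr rfl fun s _ => ?_
    simp only [hit, hy.lt_iff_lt, pow_succ', Equiv.Perm.mul_apply]
  rw [hsum]
  calc p * (θ.period * m) = (p * θ.period) * m := by ring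
    _ ≤ (n * θ.overRotationPair.1) * m :=
      Nat.mul_le_mul_right _ (hmin θ h2 ⟨y, hy, hyS, hf⟩)
    _ = n * (m * θ.overRotationPair.1) := by ring

/-! ### The `P`-linear map. -/

namespace Pattern

variable (π : Pattern)

theorem linearMap_eq {i i' : Fin π.period} (h : (i' : ℕ) = i + 1) {t : ℝ} (ht : (i : ℕ) ≤ t)
    (ht' : t ≤ (i : ℕ) + 1) :
    π.linearMap t = (π.perm i : ℕ) + (t - (i : ℕ)) * ((π.perm i' : ℕ) - (π.perm i : ℕ)) := by
  have hi' : (⟨i + 1, h ▸ i'.2⟩ : Fin π.period) = i' := Fin.ext h.symm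
  rcases ht'.lt_or_eq with hlt | rfl
  · have hfl : ⌊t⌋₊ = (i : ℕ) := by
      rw [Nat.floor_eq_iff ((Nat.cast_nonneg _).trans ht)]; exact ⟨ht, hlt⟩
    simp only [linearMap, hfl, i.2, dif_pos, Fin.eta]
    rw [dif_pos (h ▸ i'.2), hi']
  -- At the right end the floor has already jumped, so the factor `t - ⌊t⌋₊` vanishes and a default
  -- value 0 beyond the last point is harmless.
  · have hfl : ⌊((i : ℕ) : ℝ) + 1⌋₊ = (i : ℕ) + 1 := by
      rw [Nat.floor_add_one (Nat.cast_nonneg _), Nat.floor_natCast]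
    simp only [linearMap, hfl]
    rw [dif_pos (h ▸ i'.2), hi']
    push_cast
    ring

theorem exists_mem_Icc (h2 : 2 ≤ π.period) {t : ℝ} (ht : t ∈ Icc (0 : ℝ) ((π.period : ℝ) - 1)) :
    ∃ i i' : Fin π.period, (i' : ℕ) = i + 1 ∧ ((i : ℕ) : ℝ) ≤ t ∧ t ≤ (i : ℕ) + 1 := by
  by_cases h : ⌊t⌋₊ + 1 < π.period
  · exact ⟨⟨⌊t⌋₊, by omega⟩, ⟨⌊t⌋₊ + 1, h⟩, rfl, Nat.floor_le ht.1, (Nat.lt_floor_add_one t).le⟩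
  · refine ⟨⟨π.period - 2, by omega⟩, ⟨π.period - 1, by omega⟩, by simp; omega, ?_, ?_⟩
    · refine le_trans ?_ (Nat.floor_le ht.1)
      exact_mod_cast (by simp; omega : π.period - 2 ≤ ⌊t⌋₊)
    · have := ht.2
      simp only [Nat.cast_sub h2]
      push_cast
      linarith

theorem linearMap_natCast (h2 : 2 ≤ π.period) (i : Fin π.period) :
    π.linearMap ((i : ℕ) : ℝ) = (π.perm i : ℕ) := by
  by_cases h : (i : ℕ) + 1 < π.period
  · rw [π.linearMap_eq (i := i) (i' := ⟨i + 1, h⟩) rfl le_rfl (by linarith)]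
    simp
  · have hi : ((i : ℕ) - 1) + 1 = (i : ℕ) := by omega
    have hi' : (((i : ℕ) : ℝ)) = ((i : ℕ) - 1 : ℕ) + 1 := by exact_mod_cast hi.symm
    rw [π.linearMap_eq (i := ⟨i - 1, by omega⟩) (i' := i) hi.symm (by simp [hi']) hi'.le]
    simp [hi']

theorem natCast_mem_Icc (i : Fin π.period) :
    ((i : ℕ) : ℝ) ∈ Icc (0 : ℝ) ((π.period : ℝ) - 1) := by
  refine ⟨Nat.cast_nonneg _, ?_⟩
  have : ((i : ℕ) : ℝ) + 1 ≤ π.period := by exact_mod_cast i.2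
  linarith

theorem mapsTo_linearMap (h2 : 2 ≤ π.period) :
    MapsTo π.linearMap (Icc 0 ((π.period : ℝ) - 1)) (Icc 0 ((π.period : ℝ) - 1)) := by
  intro t ht
  obtain ⟨i, i', h, h1, h3⟩ := π.exists_mem_Icc h2 ht
  rw [π.linearMap_eq h h1 h3]
  have e : ∀ u v s : ℝ, u + s * (v - u) = (1 - s) • u + s • v := by
    intro u v s; simp only [smul_eq_mul]; ring
  rw [e]
  exact convex_Icc _ _ (π.natCast_mem_Icc _) (π.natCast_mem_Icc _) (by linarith) (by linarith)
    (by ring)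

theorem continuousOn_linearMap : ContinuousOn π.linearMap (Icc 0 ((π.period : ℝ) - 1)) := by
  have key : ∀ m : ℕ, m < π.period → ContinuousOn π.linearMap (Icc 0 (m : ℝ)) := by
    intro m
    induction m with
    | zero => intro _; simp
    | succ m ih =>
      intro hm
      have hunion : Icc (0 : ℝ) ((m + 1 : ℕ) : ℝ) = Icc 0 (m : ℝ) ∪ Icc (m : ℝ) (m + 1) := by
        rw [Icc_union_Icc_eq_Icc (Nat.cast_nonneg _) (by linarith)]; push_cast; rfl
      rw [hunion]
      refine (ih (by omega)).union_of_isClosed ?_ isClosed_Icc isClosed_Icc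
      refine ContinuousOn.congr (f := fun t : ℝ => ((π.perm ⟨m, by omega⟩ : ℕ) : ℝ) + (t - (m : ℝ)) *
        ((π.perm ⟨m + 1, hm⟩ : ℕ) - (π.perm ⟨m, by omega⟩ : ℕ))) (by fun_prop) ?_
      intro t ht
      exact π.linearMap_eq (i := ⟨m, by omega⟩) (i' := ⟨m + 1, hm⟩) rfl ht.1 ht.2
  have h := key (π.period - 1) (by have := π.period_pos; omega)
  rwa [Nat.cast_sub π.period_pos, Nat.cast_one] at h

theorem iterate_linearMap_natCast (h2 : 2 ≤ π.period) (t : ℕ) (i : Fin π.period) :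
    π.linearMap^[t] ((i : ℕ) : ℝ) = ((π.perm ^ t) i : ℕ) :=
  iterate_apply_eq (θ := π) (y := fun i => ((i : ℕ) : ℝ)) (π.linearMap_natCast h2) t i

theorem exhibits_linearMap (h2 : 2 ≤ π.period) :
    Exhibits π.linearMap (Icc 0 ((π.period : ℝ) - 1)) π :=
  ⟨fun i => ((i : ℕ) : ℝ), fun _ _ h => Nat.cast_lt.2 h, π.natCast_mem_Icc,
    π.linearMap_natCast h2⟩

/-! ### Minimality and the existence of a center. -/

/-- All cycles of the `P`-linear map have over-rotation number at least `ρ(π)`. -/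
def IsMinimal : Prop :=
  ∀ θ : Pattern, 2 ≤ θ.period → Exhibits π.linearMap (Icc 0 ((π.period : ℝ) - 1)) θ →
    π.overRotationPair.1 * θ.period ≤ π.period * θ.overRotationPair.1

theorem isMinimal_of_leftEndpoint_eq (hr : π.leftEndpoint = π.overRotationNumber) :
    π.IsMinimal := by
  intro θ h2 hθ
  have hbdd : BddBelow π.forcedInterval := by
    refine ⟨0, fun r hr => ?_⟩
    refine closure_minimal ?_ isClosed_Ici hr
    rintro _ ⟨θ, -, -, rfl⟩
    simp only [mem_Ici, overRotationNumber]
    positivity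
  have hle : π.overRotationNumber ≤ θ.overRotationNumber := by
    rw [← hr]
    exact csInf_le hbdd (subset_closure ⟨θ, h2, hθ, rfl⟩)
  have h1 : (0 : ℝ) < π.period := Nat.cast_pos.2 π.period_pos
  have h3 : (0 : ℝ) < θ.period := Nat.cast_pos.2 θ.period_pos
  have hle' : (π.overRotationPair.1 : ℝ) / π.period ≤ (θ.overRotationPair.1 : ℝ) / θ.period := hle
  rw [div_le_div_iff₀ h1 h3] at hle'
  rw [mul_comm π.period]
  exact_mod_cast hle'

/-- A cycle with a point moved to the left followed by a point moved to the right forces cycles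
of arbitrarily small over-rotation number. -/
theorem IsMinimal.not_divergent {π : Pattern} (hmin : π.IsMinimal) (h2 : 2 ≤ π.period)
    (hp : 0 < π.overRotationPair.1) {k k' : Fin π.period} (hk : (k' : ℕ) = k + 1)
    (hl : π.perm k < k) : ¬ k' < π.perm k' := by
  intro hr
  set f := π.linearMap with hf
  set S := Icc (0 : ℝ) ((π.period : ℝ) - 1) with hS
  have hmaps : MapsTo f S S := π.mapsTo_linearMap h2
  have hcont : ContinuousOn f S := π.continuousOn_linearMap
  have hl' : ((π.perm k : ℕ) : ℝ) + 1 ≤ (k : ℕ) := by exact_mod_cast hl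
  have hr' : ((k : ℕ) : ℝ) + 1 + 1 ≤ (π.perm k' : ℕ) := by
    have h : (k : ℕ) + 1 + 1 ≤ (π.perm k' : ℕ) := by have := Fin.lt_def.1 hr; omega
    exact_mod_cast h
  have hkS := π.natCast_mem_Icc k
  have hk'S := π.natCast_mem_Icc k'
  have hk'' : ((k' : ℕ) : ℝ) = (k : ℕ) + 1 := by exact_mod_cast hk
  set A : ℝ := (k : ℕ) - (π.perm k : ℕ) with hA
  set B : ℝ := (π.perm k' : ℕ) - (π.perm k : ℕ) - 1 with hB
  have hBpos : 0 < B := by linarith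
  have hval : ∀ t : ℝ, (k : ℕ) ≤ t → t ≤ (k : ℕ) + 1 → f t = t - A + (t - (k : ℕ)) * B := by
    intro t h h'
    rw [hf, π.linearMap_eq hk h h', hA, hB]; ring
  -- `b` is the fixed point on the affine piece [k, k + 1], whose slope is `B + 1`.
  obtain ⟨b, hb1, hb2, hb⟩ : ∃ b : ℝ, (k : ℕ) < b ∧ b < (k : ℕ) + 1 ∧ (b - (k : ℕ)) * B = A := by
    refine ⟨(k : ℕ) + A / B, ?_, ?_, ?_⟩
    · have : 0 < A / B := div_pos (by linarith) hBpos
      linarith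
    · have : A / B < 1 := (div_lt_one hBpos).2 (by linarith)
      linarith
    · field_simp
      ring
  have hfb : f b = b := by rw [hval b hb1.le hb2.le, hb]; ring
  have hfk : f (k : ℕ) = (π.perm k : ℕ) := π.linearMap_natCast h2 k
  have hKS : Icc ((k : ℕ) : ℝ) b ⊆ S := Icc_subset_Icc hkS.1 (by linarith [hk'S.2])
  -- While an orbit stays in [k, b] it never moves right, so it makes no change from plus to minus
  -- there.
  have hfK : ∀ t ∈ Icc ((k : ℕ) : ℝ) b, f t ≤ t := by
    intro t ht
    rw [hval t ht.1 (ht.2.trans hb2.le)]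
    nlinarith [mul_le_mul_of_nonneg_right (sub_le_sub_right ht.2 ((k : ℕ) : ℝ)) hBpos.le]
  have hKK : Icc ((k : ℕ) : ℝ) b ⊆ f '' Icc ((k : ℕ) : ℝ) b := by
    have := intermediate_value_Icc hb1.le (hcont.mono hKS)
    rw [hfb, hfk] at this
    exact (Icc_subset_Icc_left (by linarith)).trans this
  obtain ⟨t₀, -, ht₀⟩ := π.exists_pow_eq k ⟨0, π.period_pos⟩
  have hiter : ContinuousOn f^[t₀] (Icc ((k : ℕ) : ℝ) b) := (hcont.iterate hmaps t₀).mono hKS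
  -- The end `b` is fixed while the orbit of the other end `k` reaches 0.
  have h0 : Icc 0 b ⊆ f^[t₀] '' Icc ((k : ℕ) : ℝ) b := by
    have := intermediate_value_Icc hb1.le hiter
    rw [Function.iterate_fixed hfb, hf, π.iterate_linearMap_natCast h2, ht₀] at this
    simpa using this
  -- Otherwise the orbit of `k` would stay at or to the left of `k`, contradicting that the cycle
  -- contains `k'`.
  obtain ⟨j, hjk, hj⟩ : ∃ j : Fin π.period, j < k ∧ k < π.perm j := by
    by_contra! hcon
    have hinv : ∀ t : ℕ, (π.perm ^ t) k ≤ k := by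
      intro t
      induction t with
      | zero => exact le_rfl
      | succ t ih =>
        rw [pow_succ', Equiv.Perm.mul_apply]
        rcases ih.lt_or_eq with h | h
        · exact hcon _ h
        · rw [h]; exact hl.le
    obtain ⟨t, -, ht⟩ := π.exists_pow_eq k k'
    have := hinv t
    rw [ht, Fin.le_def] at this
    omega
  have hjS := π.natCast_mem_Icc j
  have hjk' : ((j : ℕ) : ℝ) ≤ (k : ℕ) := by exact_mod_cast hjk.le
  have hfj : b ≤ f (j : ℕ) := by
    rw [hf, π.linearMap_natCast h2]
    have : ((k : ℕ) : ℝ) + 1 ≤ (π.perm j : ℕ) := by exact_mod_cast hj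
    linarith
  have hJS : Icc ((j : ℕ) : ℝ) (k : ℕ) ⊆ S := Icc_subset_Icc hjS.1 hkS.2
  have hJK : Icc ((k : ℕ) : ℝ) b ⊆ f '' Icc ((j : ℕ) : ℝ) (k : ℕ) := by
    have := intermediate_value_Icc' hjk' (hcont.mono hJS)
    rw [hfk] at this
    exact (Icc_subset_Icc (by linarith) hfj).trans this
  have hstay : ∀ m, Follows f m (Icc ((k : ℕ) : ℝ) b) (Icc ((k : ℕ) : ℝ) b)
      (fun x => ∀ s < m, f^[s] x ∈ Icc ((k : ℕ) : ℝ) b) := by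
    intro m
    induction m with
    | zero => exact (Follows.refl f _).mono (by simp)
    | succ m ih =>
      have h1 : Follows f 1 (Icc ((k : ℕ) : ℝ) b) (Icc ((k : ℕ) : ℝ) b) (· ∈ _) :=
        Follows.of_subset_image (by simpa using hcont.mono hKS) (by simpa using hKK)
      refine (ih.trans h1).mono ?_
      rintro x ⟨hx1, hx2⟩ s hs
      rcases Nat.lt_succ_iff_lt_or_eq.1 hs with h | rfl
      · exact hx1 s h
      · exact hx2
  have hgo : Follows f t₀ (Icc ((k : ℕ) : ℝ) b) (Icc ((j : ℕ) : ℝ) (k : ℕ)) (· ∈ _) :=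
    Follows.of_subset_image hiter ((Icc_subset_Icc hjS.1 hb1.le).trans h0)
  have hback : Follows f 1 (Icc ((j : ℕ) : ℝ) (k : ℕ)) (Icc ((k : ℕ) : ℝ) b) (· ∈ _) :=
    Follows.of_subset_image (by simpa using hcont.mono hJS) (by simpa using hJK)
  -- The loop spends `m` steps in [k, b] and `t₀ + 1` steps on an excursion. Only the excursion can
  -- contribute, at most `t₀ + 1` changes, and `m` is chosen so that n times this number is still
  -- below the length of the loop.
  set m := π.period * (t₀ + 1) with hm
  obtain ⟨x, hxK, hx, ⟨hQ, -⟩, hxJ⟩ :=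
    (((hstay m).trans hgo).trans hback).exists_periodic hb1.le
  have hne : f x ≠ x := by
    intro h
    rw [Function.iterate_fixed h] at hxJ
    have : x = (k : ℕ) := le_antisymm hxJ.2 hxK.1
    rw [this, hfk] at h
    linarith
  have hbound := le_card_sign_changes hmaps hmin (hKS hxK) (by omega) hx hne
  rw [show m + t₀ + 1 = m + (t₀ + 1) by ring, Finset.sum_range_add, Finset.sum_eq_zero] at hbound
  · have hle : ∑ s ∈ Finset.range (t₀ + 1), (if f^[m + s] x < f^[m + s + 1] x ∧
        f^[m + s + 2] x < f^[m + s + 1] x then 1 else 0) ≤ t₀ + 1 := by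
      refine (Finset.sum_le_card_nsmul _ _ 1 fun s _ => ?_).trans (by simp)
      split_ifs <;> simp
    have h3 : π.period * (0 + ∑ s ∈ Finset.range (t₀ + 1), (if f^[m + s] x < f^[m + s + 1] x ∧
        f^[m + s + 2] x < f^[m + s + 1] x then 1 else 0)) ≤ m := by
      rw [zero_add]; exact Nat.mul_le_mul_left _ hle
    have h4 : 1 * (m + (t₀ + 1)) ≤ π.overRotationPair.1 * (m + (t₀ + 1)) :=
      Nat.mul_le_mul_right _ hp
    omega
  · intro s hs
    rw [if_neg]
    rintro ⟨h, -⟩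
    rw [Function.iterate_succ_apply'] at h
    exact (hfK _ (hQ s (Finset.mem_range.1 hs))).not_gt h

/-- The point `a` separates the points of the cycle moved to the right from those moved to the
left, and is fixed by the `P`-linear map. -/
structure IsCenter (a : ℝ) : Prop where
  mem : a ∈ Icc (0 : ℝ) ((π.period : ℝ) - 1)
  fixed : π.linearMap a = a
  ne (i : Fin π.period) : ((i : ℕ) : ℝ) ≠ a
  lt_perm (i : Fin π.period) : ((i : ℕ) : ℝ) < a → i < π.perm i
  perm_lt (i : Fin π.period) : a < ((i : ℕ) : ℝ) → π.perm i < i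

/-- Let `m` be the first point moved left. By `not_divergent` every later point is moved left too,
and the displacement changes sign between `m - 1` and `m`. -/
theorem IsMinimal.exists_isCenter {π : Pattern} (hmin : π.IsMinimal) (h2 : 2 ≤ π.period)
    (hp : 0 < π.overRotationPair.1) : ∃ a, π.IsCenter a := by
  have hex : ∃ i, ∃ h : i < π.period, π.perm ⟨i, h⟩ < ⟨i, h⟩ := by
    refine ⟨π.period - 1, by omega, lt_of_le_of_ne ?_ (π.perm_apply_ne h2 _)⟩
    rw [Fin.le_def]
    have := (π.perm ⟨π.period - 1, by omega⟩).2
    simp only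
    omega
  classical
  set m := Nat.find hex with hm
  obtain ⟨hmn, hmlt⟩ : ∃ h : m < π.period, π.perm ⟨m, h⟩ < ⟨m, h⟩ := Nat.find_spec hex
  have hm0 : 0 < m := by
    rw [Fin.lt_def] at hmlt
    exact lt_of_le_of_lt (Nat.zero_le _) hmlt
  have hleft : ∀ i : Fin π.period, (i : ℕ) < m → i < π.perm i := by
    intro i hi
    refine lt_of_le_of_ne (not_lt.1 fun h => ?_) (π.perm_apply_ne h2 i).symm
    exact Nat.find_min hex hi ⟨i.2, h⟩
  have hright : ∀ j (h : m + j < π.period), π.perm ⟨m + j, h⟩ < ⟨m + j, h⟩ := by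
    intro j
    induction j with
    | zero => intro h; exact hmlt
    | succ j ih =>
      intro h
      refine lt_of_le_of_ne (not_lt.1 ?_) (π.perm_apply_ne h2 _)
      exact hmin.not_divergent h2 hp (k := ⟨m + j, by omega⟩) (by simp [add_assoc])
        (ih (by omega))
  have hright' : ∀ i : Fin π.period, m ≤ (i : ℕ) → π.perm i < i := by
    intro i hi
    have := hright (i - m) (by omega)
    simpa [Nat.add_sub_cancel' hi] using this
  let k : Fin π.period := ⟨m - 1, by omega⟩
  let k' : Fin π.period := ⟨m, hmn⟩
  have hk : ((k : ℕ) : ℝ) + 1 = m := by exact_mod_cast (by simp [k]; omega : (k : ℕ) + 1 = m)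
  have hkS := π.natCast_mem_Icc k
  have hk'S := π.natCast_mem_Icc k'
  have hsub : Icc ((k : ℕ) : ℝ) (k' : ℕ) ⊆ Icc (0 : ℝ) ((π.period : ℝ) - 1) :=
    Icc_subset_Icc hkS.1 hk'S.2
  have hgk : (((k : ℕ) : ℝ)) < (π.perm k : ℕ) := by
    exact_mod_cast hleft k (by simp [k]; omega)
  have hgk' : (((π.perm k' : ℕ)) : ℝ) < (k' : ℕ) := by exact_mod_cast hmlt
  have hc : ContinuousOn (fun t => π.linearMap t - t) (Icc ((k : ℕ) : ℝ) (k' : ℕ)) :=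
    (π.continuousOn_linearMap.mono hsub).sub continuousOn_id
  obtain ⟨a, ha, hfa⟩ := intermediate_value_Icc' (by simp only [k']; linarith) hc
    (show (0 : ℝ) ∈ _ by
      rw [π.linearMap_natCast h2, π.linearMap_natCast h2]
      constructor <;> linarith)
  have hfa' : π.linearMap a = a := by simpa [sub_eq_zero] using hfa
  have hne : ∀ i : Fin π.period, ((i : ℕ) : ℝ) ≠ a := by
    rintro i rfl
    rw [π.linearMap_natCast h2] at hfa'
    exact π.perm_apply_ne h2 i (Fin.ext (by exact_mod_cast hfa'))
  refine ⟨a, hsub ha, hfa', hne, fun i hi => hleft i ?_, fun i hi => hright' i ?_⟩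
  · have := hi.trans_le ha.2
    exact_mod_cast this
  · have h := ha.1.trans_lt hi
    have h' : (m - 1 : ℕ) < (i : ℕ) := by exact_mod_cast h
    omega

/-! ### Loops in a weighted graph on the points of a cycle -/

section Combinatorics

variable {π}

/-- `T x` is the time at which the orbit of `x₀` reaches `x` during its first turn; the second
alternative is the end of the turn. -/
theorem exists_index (π : Pattern) (x₀ : Fin π.period) : ∃ T : Fin π.period → ℕ, T x₀ = 0 ∧
    (∀ x, (π.perm ^ T x) x₀ = x) ∧
    ∀ x, T (π.perm x) = T x + 1 ∨ (T (π.perm x) = 0 ∧ T x + 1 = π.period ∧ π.perm x = x₀) := by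
  choose T hT hTx using π.exists_pow_eq x₀
  have h0 : T x₀ = 0 := π.pow_apply_inj (hT _) π.period_pos (i := x₀) (by rw [hTx]; rfl)
  refine ⟨T, h0, hTx, fun x => ?_⟩
  have hsucc : (π.perm ^ (T x + 1)) x₀ = π.perm x := by
    rw [pow_succ', Equiv.Perm.mul_apply, hTx]
  rcases (Nat.succ_le_of_lt (hT x)).lt_or_eq with h | h
  · left
    exact π.pow_apply_inj (hT _) h (i := x₀) (by rw [hTx, ← hsucc])
  · right
    have h' : T x + 1 = π.period := h
    have : π.perm x = x₀ := by rw [← hsucc, h', π.pow_apply_eq_iff]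
    exact ⟨by rw [this, h0], h', this⟩

/-- A relation that can be followed along a cycle and is trivial at one point of it can be
followed by a function on the cycle. -/
theorem exists_section {E R : Fin π.period → Fin π.period → Prop} (x₀ : Fin π.period)
    (hR : R x₀ x₀) (huniq : ∀ j, R x₀ j → j = x₀)
    (hstep : ∀ x j, R x j → ∃ l, E j l ∧ R (π.perm x) l) :
    ∃ τ : Fin π.period → Fin π.period, ∀ x, R x (τ x) ∧ E (τ x) (τ (π.perm x)) := by
  have hstep' : ∀ x j, ∃ l, R x j → E j l ∧ R (π.perm x) l := by
    intro x j
    by_cases h : R x j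
    · obtain ⟨l, hl⟩ := hstep x j h
      exact ⟨l, fun _ => hl⟩
    · exact ⟨j, fun h' => absurd h' h⟩
  choose F hF using hstep'
  let c : ℕ → Fin π.period := fun t => Nat.rec x₀ (fun s j => F ((π.perm ^ s) x₀) j) t
  have hc : ∀ t, c (t + 1) = F ((π.perm ^ t) x₀) (c t) := fun t => rfl
  have hRc : ∀ t, R ((π.perm ^ t) x₀) (c t) := by
    intro t
    induction t with
    | zero => exact hR
    | succ t ih =>
      rw [hc, pow_succ', Equiv.Perm.mul_apply]
      exact (hF _ _ ih).2
  have hEc : ∀ t, E (c t) (c (t + 1)) := fun t => (hF _ _ (hRc t)).1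
  obtain ⟨T, hT0, hTx, hT⟩ := π.exists_index x₀
  refine ⟨fun x => c (T x), fun x => ⟨?_, ?_⟩⟩
  · have := hRc (T x)
    rwa [hTx] at this
  · change E (c (T x)) (c (T (π.perm x)))
    have h1 := hEc (T x)
    rcases hT x with h | ⟨h0, hn, hx⟩
    · rwa [h]
    · rw [h0]
      -- After a full turn the walk is again at a point related to `x₀`; by uniqueness this is `x₀`,
      -- so the walk closes up.
      have h2 := hRc (T x + 1)
      rw [pow_succ', Equiv.Perm.mul_apply, hTx, hx] at h2
      rwa [huniq _ h2] at h1

/-- Partial sums of `g` along the orbit are consistent after a full turn because the total is zero.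
-/
theorem exists_potential (x₀ : Fin π.period) (g : Fin π.period → ℤ) (hg : ∑ x, g x = 0) :
    ∃ h : Fin π.period → ℤ, ∀ x, h (π.perm x) - h x = g x := by
  obtain ⟨T, -, hTx, hT⟩ := π.exists_index x₀
  refine ⟨fun x => ∑ s ∈ Finset.range (T x), g ((π.perm ^ s) x₀), fun x => ?_⟩
  have hs := Finset.sum_range_succ (fun s => g ((π.perm ^ s) x₀)) (T x)
  rw [hTx] at hs
  rcases hT x with h | ⟨h0, hn, -⟩
  · simp only [h, hs]; ring
  · rw [hn, π.sum_range_period g x₀, hg] at hs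
    simp only [h0, Finset.range_zero, Finset.sum_empty]
    linarith

variable {E : Fin π.period → Fin π.period → Prop} {w : Fin π.period → Fin π.period → ℕ} {p : ℕ}

/-- A repeated value cuts the closed walk of length n and weight p into loops of lengths r and n -
r. Their two lower bounds add up to an equality, so each is an equality: p r = n W₁. Coprimality
gives n ∣ r, impossible for 0 < r < n. -/
theorem injective_of_loop_bound (hcop : Nat.Coprime p π.period)
    (hloop : ∀ (c : ℕ → Fin π.period) (L : ℕ), 0 < L → (∀ i < L, E (c i) (c (i + 1))) →
      c L = c 0 → p * L ≤ π.period * ∑ i ∈ Finset.range L, w (c i) (c (i + 1)))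
    {τ : Fin π.period → Fin π.period} (hE : ∀ x, E (τ x) (τ (π.perm x)))
    (hw : ∑ x, w (τ x) (τ (π.perm x)) = p) : Function.Injective τ := by
  intro x x' hxx'
  obtain ⟨r, hr, rfl⟩ := π.exists_pow_eq x x'
  rcases Nat.eq_zero_or_pos r with rfl | hr0
  · rfl
  exfalso
  have hs : ∀ (t : ℕ) z, (π.perm ^ (t + 1)) z = π.perm ((π.perm ^ t) z) := by
    intro t z; rw [pow_succ', Equiv.Perm.mul_apply]
  have hadd : ∀ t, (π.perm ^ t) ((π.perm ^ r) x) = (π.perm ^ (r + t)) x := by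
    intro t; rw [← Equiv.Perm.mul_apply, ← pow_add, add_comm]
  have h1 := hloop (fun t => τ ((π.perm ^ t) x)) r hr0
    (fun i _ => by simp only [hs]; exact hE _) (by simpa using hxx'.symm)
  have h2 := hloop (fun t => τ ((π.perm ^ t) ((π.perm ^ r) x))) (π.period - r) (by omega)
    (fun i _ => by simp only [hs]; exact hE _) (by
      simp only [hadd]
      rw [Nat.add_sub_cancel' hr.le, (π.pow_apply_eq_iff x _).2 dvd_rfl]
      simpa using hxx')
  have h3 : (∑ i ∈ Finset.range r, w (τ ((π.perm ^ i) x)) (τ ((π.perm ^ (i + 1)) x))) +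
      (∑ i ∈ Finset.range (π.period - r), w (τ ((π.perm ^ i) ((π.perm ^ r) x)))
        (τ ((π.perm ^ (i + 1)) ((π.perm ^ r) x)))) = p := by
    rw [← hw, ← π.sum_range_period (fun x => w (τ x) (τ (π.perm x))) x]
    have hsplit := Finset.sum_range_add
      (fun s => w (τ ((π.perm ^ s) x)) (τ (π.perm ((π.perm ^ s) x)))) r (π.period - r)
    rw [Nat.add_sub_cancel' hr.le] at hsplit
    rw [hsplit]
    simp only [hs, hadd]
  set W₁ := ∑ i ∈ Finset.range r, w (τ ((π.perm ^ i) x)) (τ ((π.perm ^ (i + 1)) x))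
  set W₂ := ∑ i ∈ Finset.range (π.period - r), w (τ ((π.perm ^ i) ((π.perm ^ r) x)))
        (τ ((π.perm ^ (i + 1)) ((π.perm ^ r) x)))
  have h4 : p * r + p * (π.period - r) = π.period * W₁ + π.period * W₂ := by
    rw [← mul_add, ← mul_add, h3, Nat.add_sub_cancel' hr.le, mul_comm]
  have h5 : p * r = π.period * W₁ := by omega
  have h6 : π.period ∣ r := hcop.symm.dvd_of_dvd_mul_left ⟨W₁, h5⟩
  exact absurd (Nat.le_of_dvd hr0 h6) (by omega)

/-- The potential makes every edge from x to `π.perm x` tight. An arbitrary edge from i to j closes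
up with the path of `π` from j back to i, of length r; the loop bound for it is the stated
inequality. In case of equality coprimality gives n ∣ r + 1, so the edge itself completes a turn of
`π` and j is the image of i. -/
theorem exists_strict_potential (hcop : Nat.Coprime p π.period) (x₀ : Fin π.period)
    (hloop : ∀ (c : ℕ → Fin π.period) (L : ℕ), 0 < L → (∀ i < L, E (c i) (c (i + 1))) →
      c L = c 0 → p * L ≤ π.period * ∑ i ∈ Finset.range L, w (c i) (c (i + 1)))
    (hE : ∀ x, E x (π.perm x)) (hw : ∑ x, w x (π.perm x) = p) :
    ∃ h : Fin π.period → ℤ, ∀ i j, E i j → h j - h i ≤ π.period * w i j - p ∧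
      (h j - h i = π.period * w i j - p → j = π.perm i) := by
  obtain ⟨h, hh⟩ := exists_potential x₀ (fun x => (π.period * w x (π.perm x) - p : ℤ)) (by
    rw [Finset.sum_sub_distrib, ← Finset.mul_sum]
    have : (∑ x, (w x (π.perm x) : ℤ)) = p := by exact_mod_cast hw
    rw [this]
    simp)
  refine ⟨h, fun i j hij => ?_⟩
  obtain ⟨r, hr, hri⟩ := π.exists_pow_eq j i
  have hs : ∀ (t : ℕ) z, (π.perm ^ (t + 1)) z = π.perm ((π.perm ^ t) z) := by
    intro t z; rw [pow_succ', Equiv.Perm.mul_apply]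
  set W := ∑ s ∈ Finset.range r, w ((π.perm ^ s) j) ((π.perm ^ (s + 1)) j) with hW
  have htel : h i - h j = π.period * W - p * r := by
    have := Finset.sum_range_sub (fun s => h ((π.perm ^ s) j)) r
    simp only [hri, pow_zero, Equiv.Perm.one_apply] at this
    rw [← this, hW]
    simp only [hs, hh, Finset.sum_sub_distrib, ← Finset.mul_sum]
    simp [mul_comm]
  -- The path of `π` from `j` to `i`, with the edge back to `j` as its last step.
  let c : ℕ → Fin π.period := fun t => if t ≤ r then (π.perm ^ t) j else j
  have hcl : ∀ t ≤ r, c t = (π.perm ^ t) j := fun t ht => if_pos ht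
  have hcr : c (r + 1) = j := if_neg (by omega)
  have hbound := hloop c (r + 1) (by omega) (fun t ht => by
    rcases (Nat.lt_succ_iff.1 ht).lt_or_eq with h | rfl
    · rw [hcl t h.le, hcl (t + 1) h, hs]; exact hE _
    · rw [hcl t le_rfl, hcr, hri]; exact hij) (by rw [hcr, hcl 0 (Nat.zero_le _)]; rfl)
  have hsum : ∑ t ∈ Finset.range (r + 1), w (c t) (c (t + 1)) = W + w i j := by
    rw [Finset.sum_range_succ, hcr, hcl r le_rfl, hri]
    congr 1
    refine Finset.sum_congr rfl fun t ht => ?_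
    have := Finset.mem_range.1 ht
    rw [hcl t this.le, hcl (t + 1) this]
  rw [hsum] at hbound
  zify at hbound
  constructor
  · linarith
  · intro heq
    have h7 : (p * (r + 1) : ℤ) = π.period * (W + w i j) := by linarith
    have h8 : p * (r + 1) = π.period * (W + w i j) := by exact_mod_cast h7
    have h9 : π.period ∣ r + 1 := hcop.symm.dvd_of_dvd_mul_left ⟨_, h8⟩
    rw [← hri, ← hs, (π.pow_apply_eq_iff j _).2 h9]

end Combinatorics

theorem eq_of_strictMono_semiconj {π θ : Pattern} (hper : θ.period = π.period)
    {v : Fin θ.period → Fin π.period} (hv : StrictMono v)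
    (hsemi : ∀ i, v (θ.perm i) = π.perm (v i)) : θ = π := by
  obtain ⟨n, hn, P, hP⟩ := π
  obtain ⟨q, hq, Q, hQ⟩ := θ
  simp only at hper
  subst hper
  have hid : ∀ i, v i = i := fun i => le_antisymm hv.apply_le hv.le_apply
  have : Q = P := by
    ext i
    have := hsemi i
    simp only [hid] at this
    rw [this]
  subst this
  rfl

/-! ### Cells and their position relative to the center. -/

/-- The end point of the cell of `j` in the direction of the center `a`. -/
noncomputable def innerEnd {n : ℕ} (a : ℝ) (j : Fin n) : ℝ :=
  if ((j : ℕ) : ℝ) < a then min (((j : ℕ) : ℝ) + 1) a else max (((j : ℕ) : ℝ) - 1) a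

/-- The cell of `j`: the closed interval between `j` and its neighbour in the direction of `a`. -/
def cell {n : ℕ} (a : ℝ) (j : Fin n) : Set ℝ := uIcc ((j : ℕ) : ℝ) (innerEnd a j)

/-- The cell of `j` without its inner end point. -/
def InCell {n : ℕ} (a : ℝ) (j : Fin n) (t : ℝ) : Prop :=
  (((j : ℕ) : ℝ) ≤ t ∧ t < (j : ℕ) + 1 ∧ t < a) ∨ (((j : ℕ) : ℝ) - 1 < t ∧ t ≤ (j : ℕ) ∧ a < t)

namespace IsCenter

variable {π} {a : ℝ}

theorem mem_cell_iff (ha : π.IsCenter a) {j : Fin π.period} {t : ℝ} :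
    t ∈ cell a j ↔ (((j : ℕ) : ℝ) < a ∧ ((j : ℕ) : ℝ) ≤ t ∧ t ≤ (j : ℕ) + 1 ∧ t ≤ a) ∨
      (a < ((j : ℕ) : ℝ) ∧ ((j : ℕ) : ℝ) - 1 ≤ t ∧ t ≤ (j : ℕ) ∧ a ≤ t) := by
  rcases lt_or_gt_of_ne (ha.ne j) with h | h
  · have hle : ((j : ℕ) : ℝ) ≤ min (((j : ℕ) : ℝ) + 1) a := le_min (by linarith) h.le
    rw [cell, innerEnd, if_pos h, uIcc_of_le hle, mem_Icc, le_min_iff]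
    simp [h, h.not_gt]
  · have hle : max (((j : ℕ) : ℝ) - 1) a ≤ (j : ℕ) := max_le (by linarith) h.le
    rw [cell, innerEnd, if_neg h.not_gt, uIcc_of_ge hle, mem_Icc, max_le_iff]
    simp only [h, h.not_gt]
    tauto

theorem inCell_iff (ha : π.IsCenter a) {j : Fin π.period} {t : ℝ} :
    InCell a j t ↔ t ∈ cell a j ∧ t ≠ innerEnd a j := by
  rw [ha.mem_cell_iff, InCell, innerEnd]
  rcases lt_or_gt_of_ne (ha.ne j) with h | h
  · rw [if_pos h]
    constructor
    · rintro (⟨h1, h2, h3⟩ | ⟨h1, h2, h3⟩)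
      · exact ⟨Or.inl ⟨h, h1, h2.le, h3.le⟩, (lt_min h2 h3).ne⟩
      · linarith
    · rintro ⟨⟨-, h1, h2, h3⟩ | ⟨h1, -⟩, hne⟩
      · have := lt_of_le_of_ne (le_min h2 h3) hne
        exact Or.inl ⟨h1, (lt_min_iff.1 this).1, (lt_min_iff.1 this).2⟩
      · linarith
  · rw [if_neg h.not_gt]
    constructor
    · rintro (⟨h1, h2, h3⟩ | ⟨h1, h2, h3⟩)
      · linarith
      · exact ⟨Or.inr ⟨h, h1.le, h2, h3.le⟩, (max_lt h1 h3).ne'⟩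
    · rintro ⟨⟨h1, -⟩ | ⟨-, h1, h2, h3⟩, hne⟩
      · linarith
      · have := lt_of_le_of_ne (max_le h1 h3) hne.symm
        exact Or.inr ⟨(max_lt_iff.1 this).1, h2, (max_lt_iff.1 this).2⟩

theorem natCast_mem_cell (j : Fin π.period) : ((j : ℕ) : ℝ) ∈ cell a j := left_mem_uIcc

theorem ne_innerEnd (ha : π.IsCenter a) (j : Fin π.period) : ((j : ℕ) : ℝ) ≠ innerEnd a j := by
  rw [innerEnd]
  rcases lt_or_gt_of_ne (ha.ne j) with h | h
  · rw [if_pos h]; exact (lt_min (by linarith) h).ne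
  · rw [if_neg h.not_gt]; exact (max_lt (by linarith) h).ne'

theorem exists_succ (ha : π.IsCenter a) {j : Fin π.period} (h : ((j : ℕ) : ℝ) < a) :
    ∃ j' : Fin π.period, (j' : ℕ) = j + 1 := by
  have h1 : ((j : ℕ) : ℝ) + 1 < π.period := by linarith [ha.mem.2]
  exact ⟨⟨j + 1, by exact_mod_cast h1⟩, rfl⟩

theorem exists_pred (ha : π.IsCenter a) {j : Fin π.period} (h : a < ((j : ℕ) : ℝ)) :
    ∃ j' : Fin π.period, (j : ℕ) = j' + 1 := by
  have h1 : (0 : ℝ) < (j : ℕ) := by linarith [ha.mem.1]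
  have h2 : 0 < (j : ℕ) := by exact_mod_cast h1
  exact ⟨⟨j - 1, by omega⟩, by simp; omega⟩

/-- The points of the cycle and the center. -/
def special (π : Pattern) (a : ℝ) : Set ℝ := insert a (range fun i : Fin π.period => ((i : ℕ) : ℝ))

theorem innerEnd_mem_special (ha : π.IsCenter a) (j : Fin π.period) :
    innerEnd a j ∈ special π a := by
  rw [innerEnd]
  rcases lt_or_gt_of_ne (ha.ne j) with h | h
  · rw [if_pos h]
    obtain ⟨j', hj'⟩ := ha.exists_succ h
    rcases min_choice (((j : ℕ) : ℝ) + 1) a with h' | h' <;> rw [h']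
    · exact Or.inr ⟨j', by simp [hj']⟩
    · exact Or.inl rfl
  · rw [if_neg h.not_gt]
    obtain ⟨j', hj'⟩ := ha.exists_pred h
    rcases max_choice (((j : ℕ) : ℝ) - 1) a with h' | h' <;> rw [h']
    · exact Or.inr ⟨j', by simp [hj']⟩
    · exact Or.inl rfl

/-- No special point lies in the interior of a cell. Both halves hold for every `j`; the one for the
wrong side of `a` is void. -/
theorem not_mem_Ioo_of_special {z : ℝ} (hz : z ∈ special π a) {j : Fin π.period} :
    (z ≤ (j : ℕ) ∨ min (((j : ℕ) : ℝ) + 1) a ≤ z) ∧ (z ≤ max (((j : ℕ) : ℝ) - 1) a ∨ (j : ℕ) ≤ z) := by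
  rcases hz with rfl | ⟨i, rfl⟩
  · exact ⟨Or.inr (min_le_right _ _), Or.inl (le_max_right _ _)⟩
  · rcases lt_trichotomy i j with h | rfl | h
    · have h' : ((i : ℕ) : ℝ) + 1 ≤ (j : ℕ) := by exact_mod_cast h
      exact ⟨Or.inl (by linarith), Or.inl (le_max_of_le_left (by linarith))⟩
    · exact ⟨Or.inl le_rfl, Or.inr le_rfl⟩
    · have h' : ((j : ℕ) : ℝ) + 1 ≤ (i : ℕ) := by exact_mod_cast h
      exact ⟨Or.inr (min_le_of_left_le h'), Or.inr (by linarith)⟩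

/-- An interval with special end points cannot cut a cell, so meeting the half-open cell away from
these ends means containing all of it. -/
theorem cell_subset_of_inCell (ha : π.IsCenter a) {A B z : ℝ} (hA : A ∈ special π a)
    (hB : B ∈ special π a) {j : Fin π.period} (hz : InCell a j z) (hzAB : z ∈ uIcc A B)
    (hzA : z ≠ A) (hzB : z ≠ B) : cell a j ⊆ uIcc A B := by
  wlog hAB : A ≤ B generalizing A B
  · rw [uIcc_comm] at hzAB ⊢
    exact this hB hA hzAB hzB hzA (le_of_not_ge hAB)
  rw [uIcc_of_le hAB] at hzAB ⊢
  have h1 : A < z := lt_of_le_of_ne hzAB.1 hzA.symm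
  have h2 : z < B := lt_of_le_of_ne hzAB.2 hzB
  have gA := not_mem_Ioo_of_special hA (j := j)
  have gB := not_mem_Ioo_of_special hB (j := j)
  intro t ht
  rw [ha.mem_cell_iff] at ht
  rcases hz with ⟨k1, k2, k3⟩ | ⟨k1, k2, k3⟩
  · rcases ht with ⟨m1, m2, m3, m4⟩ | ⟨m1, -⟩
    · constructor
      · rcases gA.1 with h | h
        · linarith
        · linarith [lt_min k2 k3]
      · rcases gB.1 with h | h
        · linarith
        · exact (le_min m3 m4).trans h
    · linarith
  · rcases ht with ⟨m1, -⟩ | ⟨m1, m2, m3, m4⟩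
    · linarith
    · constructor
      · rcases gA.2 with h | h
        · exact h.trans (max_le m2 m4)
        · linarith
      · rcases gB.2 with h | h
        · linarith [max_lt k1 k3]
        · linarith

/-- If `B` lies on the inner side of `i`, the cell of `i` works; if it lies on the outer side, the
cell of the outer neighbour does, as its inner end is `i`. -/
theorem exists_cell_subset (ha : π.IsCenter a) {B : ℝ} (hB : B ∈ special π a)
    (i : Fin π.period) (hne : ((i : ℕ) : ℝ) ≠ B) :
    ∃ l : Fin π.period, cell a l ⊆ uIcc ((i : ℕ) : ℝ) B ∧ ((i : ℕ) : ℝ) ∈ cell a l := by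
  have g := not_mem_Ioo_of_special hB (j := i)
  rcases lt_or_gt_of_ne (ha.ne i) with h | h <;> rcases lt_or_gt_of_ne hne with h' | h'
  · refine ⟨i, ?_, natCast_mem_cell i⟩
    rw [uIcc_of_le h'.le]
    intro t ht
    rcases ha.mem_cell_iff.1 ht with ⟨m1, m2, m3, m4⟩ | ⟨m1, -⟩
    · exact ⟨m2, (le_min m3 m4).trans (g.1.resolve_left h'.not_ge)⟩
    · linarith
  · obtain ⟨b, rfl⟩ : ∃ b : Fin π.period, ((b : ℕ) : ℝ) = B := by
      rcases hB with rfl | hB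
      · linarith
      · exact hB
    have hb : (b : ℕ) < i := by exact_mod_cast h'
    have hb' : ((b : ℕ) : ℝ) + 1 ≤ (i : ℕ) := by exact_mod_cast hb
    let l : Fin π.period := ⟨i - 1, by omega⟩
    have hl : ((l : ℕ) : ℝ) + 1 = (i : ℕ) := by
      exact_mod_cast (by simp [l]; omega : (l : ℕ) + 1 = (i : ℕ))
    refine ⟨l, ?_, ha.mem_cell_iff.2 (Or.inl ⟨by linarith, by linarith, hl.ge, h.le⟩)⟩
    rw [uIcc_of_ge h'.le]
    intro t ht
    rcases ha.mem_cell_iff.1 ht with ⟨m1, m2, m3, m4⟩ | ⟨m1, -⟩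
    · exact ⟨by linarith, by linarith⟩
    · linarith
  · obtain ⟨b, rfl⟩ : ∃ b : Fin π.period, ((b : ℕ) : ℝ) = B := by
      rcases hB with rfl | hB
      · linarith
      · exact hB
    have hb : (i : ℕ) < b := by exact_mod_cast h'
    have hb' : ((i : ℕ) : ℝ) + 1 ≤ (b : ℕ) := by exact_mod_cast hb
    let l : Fin π.period := ⟨i + 1, by omega⟩
    have hl : ((l : ℕ) : ℝ) = (i : ℕ) + 1 := by simp [l]
    refine ⟨l, ?_, ha.mem_cell_iff.2 (Or.inr ⟨by linarith, by linarith, by linarith, h.le⟩)⟩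
    rw [uIcc_of_le h'.le]
    intro t ht
    rcases ha.mem_cell_iff.1 ht with ⟨m1, -⟩ | ⟨m1, m2, m3, m4⟩
    · linarith
    · exact ⟨by linarith, by linarith⟩
  · refine ⟨i, ?_, natCast_mem_cell i⟩
    rw [uIcc_of_ge h'.le]
    intro t ht
    rcases ha.mem_cell_iff.1 ht with ⟨m1, -⟩ | ⟨m1, m2, m3, m4⟩
    · linarith
    · exact ⟨(g.2.resolve_right h'.not_ge).trans (max_le m2 m4), m3⟩

theorem exists_inCell (h2 : 2 ≤ π.period) {t : ℝ}
    (ht : t ∈ Icc (0 : ℝ) ((π.period : ℝ) - 1)) (hta : t ≠ a) :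
    ∃ j : Fin π.period, InCell a j t := by
  obtain ⟨i, i', h, h1, h3⟩ := π.exists_mem_Icc h2 ht
  have hi' : ((i' : ℕ) : ℝ) = (i : ℕ) + 1 := by exact_mod_cast h
  rcases lt_or_gt_of_ne hta with hlt | hlt
  · rcases h3.lt_or_eq with h4 | h4
    · exact ⟨i, Or.inl ⟨h1, h4, hlt⟩⟩
    · exact ⟨i', Or.inl ⟨by linarith, by linarith, hlt⟩⟩
  · rcases h1.lt_or_eq with h4 | h4
    · exact ⟨i', Or.inr ⟨by linarith, by linarith, hlt⟩⟩
    · exact ⟨i, Or.inr ⟨by linarith, by linarith, hlt⟩⟩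

/-- The half-open cells are disjoint and ordered like their points, so the assignment of cells to
the points of a cycle is well defined and monotone. -/
theorem inCell_mono {j j' : Fin π.period} {t t' : ℝ} (ht : InCell a j t) (ht' : InCell a j' t')
    (htt' : t ≤ t') : j ≤ j' := by
  have key : ((j : ℕ) : ℝ) < (j' : ℕ) + 1 := by
    rcases ht with ⟨h1, h2, h3⟩ | ⟨h1, h2, h3⟩ <;> rcases ht' with ⟨k1, k2, k3⟩ | ⟨k1, k2, k3⟩ <;>
      linarith
  have : (j : ℕ) < j' + 1 := by exact_mod_cast key
  rw [Fin.le_def]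
  omega

theorem mem_cell_lt_iff (ha : π.IsCenter a) {j : Fin π.period} {t : ℝ} (ht : t ∈ cell a j)
    (hta : t ≠ a) : ((j : ℕ) : ℝ) < a ↔ t < a := by
  rcases ha.mem_cell_iff.1 ht with ⟨h, h1, h2, h3⟩ | ⟨h, h1, h2, h3⟩
  · exact ⟨fun _ => lt_of_le_of_ne h3 hta, fun _ => h⟩
  · constructor <;> intro h' <;> linarith

theorem eq_of_inCell_of_dist_eq {j : Fin π.period} {t t' : ℝ}
    (ht : InCell a j t) (ht' : InCell a j t') (h : |t - (j : ℕ)| = |t' - (j : ℕ)|) : t = t' := by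
  rcases ht with ⟨h1, h2, h3⟩ | ⟨h1, h2, h3⟩ <;> rcases ht' with ⟨k1, k2, k3⟩ | ⟨k1, k2, k3⟩
  · rw [abs_of_nonneg (by linarith), abs_of_nonneg (by linarith)] at h; linarith
  · linarith
  · linarith
  · rw [abs_of_nonpos (by linarith), abs_of_nonpos (by linarith)] at h; linarith

theorem cell_subset_Icc (ha : π.IsCenter a) (j : Fin π.period) :
    cell a j ⊆ Icc (0 : ℝ) ((π.period : ℝ) - 1) := by
  intro t ht
  have := π.natCast_mem_Icc j
  have := ha.mem
  simp only [mem_Icc] at *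
  rcases ha.mem_cell_iff.1 ht with ⟨h, h1, h2, h3⟩ | ⟨h, h1, h2, h3⟩ <;>
    constructor <;> linarith

theorem exists_affine (ha : π.IsCenter a) (j : Fin π.period) :
    ∃ m : ℝ, ∀ t ∈ cell a j, π.linearMap t = (π.perm j : ℕ) + m * (t - (j : ℕ)) := by
  rcases lt_or_gt_of_ne (ha.ne j) with h | h
  · obtain ⟨j', hj'⟩ := ha.exists_succ h
    refine ⟨(π.perm j' : ℕ) - (π.perm j : ℕ), fun t ht => ?_⟩
    rcases ha.mem_cell_iff.1 ht with ⟨-, h1, h2, h3⟩ | ⟨h', -⟩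
    · rw [π.linearMap_eq hj' h1 h2]; ring
    · linarith
  · obtain ⟨j', hj'⟩ := ha.exists_pred h
    have hj : ((j : ℕ) : ℝ) = (j' : ℕ) + 1 := by exact_mod_cast hj'
    refine ⟨(π.perm j : ℕ) - (π.perm j' : ℕ), fun t ht => ?_⟩
    rcases ha.mem_cell_iff.1 ht with ⟨h', -⟩ | ⟨-, h1, h2, h3⟩
    · linarith
    · rw [π.linearMap_eq hj' (by linarith) (by linarith), hj]; ring

/-- The map interpolates either between two cycle points moved in the same direction or, in the
central gap, between such a point and the fixed point `a`. -/
theorem lt_linearMap (ha : π.IsCenter a) {j : Fin π.period} {t : ℝ} (ht : t ∈ cell a j) :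
    (t < a → t < π.linearMap t) ∧ (a < t → π.linearMap t < t) := by
  rcases ha.mem_cell_iff.1 ht with ⟨h, h1, h2, h3⟩ | ⟨h, h1, h2, h3⟩
  · refine ⟨fun hlt => ?_, fun hlt => absurd h3 hlt.not_ge⟩
    obtain ⟨j', hj'⟩ := ha.exists_succ h
    have hjj : ((j' : ℕ) : ℝ) = (j : ℕ) + 1 := by exact_mod_cast hj'
    have e := π.linearMap_eq hj' h1 h2
    have hj : ((j : ℕ) : ℝ) < (π.perm j : ℕ) := by exact_mod_cast ha.lt_perm j h
    rcases lt_or_gt_of_ne (ha.ne j') with h4 | h4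
    · have hp : ((j' : ℕ) : ℝ) < (π.perm j' : ℕ) := by exact_mod_cast ha.lt_perm j' h4
      rw [e]
      rcases h1.lt_or_eq with h5 | h5
      · nlinarith
      · rw [← h5]; linarith
    · have e' := π.linearMap_eq hj' h.le (by linarith)
      rw [ha.fixed] at e'
      rw [e]
      have : (a - t) * ((π.perm j : ℕ) - ((j : ℕ) : ℝ)) > 0 :=
        mul_pos (by linarith) (by linarith)
      by_contra! hcon
      nlinarith
  · refine ⟨fun hlt => absurd h3 hlt.not_ge, fun hlt => ?_⟩
    obtain ⟨j', hj'⟩ := ha.exists_pred h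
    have hjj : ((j : ℕ) : ℝ) = (j' : ℕ) + 1 := by exact_mod_cast hj'
    have e := π.linearMap_eq hj' (t := t) (by linarith) (by linarith)
    have hj : ((π.perm j : ℕ) : ℝ) < (j : ℕ) := by exact_mod_cast ha.perm_lt j h
    rcases lt_or_gt_of_ne (ha.ne j') with h4 | h4
    · have e' := π.linearMap_eq hj' h4.le (by linarith)
      rw [ha.fixed] at e'
      rw [e]
      have : (t - a) * (((j : ℕ) : ℝ) - (π.perm j : ℕ)) > 0 :=
        mul_pos (by linarith) (by linarith)
      by_contra! hcon
      nlinarith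
    · have hp : ((π.perm j' : ℕ) : ℝ) < (j' : ℕ) := by exact_mod_cast ha.perm_lt j' h4
      rw [e]
      rcases h2.lt_or_eq with h5 | h5
      · nlinarith
      · rw [h5]; nlinarith

end IsCenter

/-! ### The covering graph of the cells and its loops. -/

/-- The cell of `i` covers the cell of `j` under the `P`-linear map. -/
def CellCovers (π : Pattern) (a : ℝ) (i j : Fin π.period) : Prop :=
  cell a j ⊆ uIcc ((π.perm i : ℕ) : ℝ) (π.linearMap (innerEnd a i))

/-- The indicator of a passage from the left to the right of `a`. -/
noncomputable def crossing {n : ℕ} (a : ℝ) (i j : Fin n) : ℕ :=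
  if ((i : ℕ) : ℝ) < a ∧ a < ((j : ℕ) : ℝ) then 1 else 0

namespace IsCenter

variable {π} {a : ℝ}

theorem linearMap_mem_special (h2 : 2 ≤ π.period) (ha : π.IsCenter a) {z : ℝ}
    (hz : z ∈ special π a) : π.linearMap z ∈ special π a := by
  rcases hz with rfl | ⟨i, rfl⟩
  · rw [ha.fixed]; exact Or.inl rfl
  · exact Or.inr ⟨π.perm i, (π.linearMap_natCast h2 i).symm⟩

theorem natCast_mem_special (i : Fin π.period) : ((i : ℕ) : ℝ) ∈ special π a := Or.inr ⟨i, rfl⟩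

theorem linearMap_ne (h2 : 2 ≤ π.period) (ha : π.IsCenter a) {z : ℝ} (hz : z ∈ special π a)
    {i : Fin π.period} (hne : ((i : ℕ) : ℝ) ≠ z) :
    ((π.perm i : ℕ) : ℝ) ≠ π.linearMap z := by
  rcases hz with rfl | ⟨j, rfl⟩
  · rw [ha.fixed]; exact ha.ne _
  · intro h
    simp only [π.linearMap_natCast h2] at h
    have h' : π.perm i = π.perm j := Fin.ext (by exact_mod_cast h)
    exact hne (by rw [π.perm.injective h'])

theorem linearMap_innerEnd_ne (h2 : 2 ≤ π.period) (ha : π.IsCenter a) (j : Fin π.period) :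
    ((π.perm j : ℕ) : ℝ) ≠ π.linearMap (innerEnd a j) :=
  ha.linearMap_ne h2 (ha.innerEnd_mem_special j) (ha.ne_innerEnd j)

theorem cell_subset_image (h2 : 2 ≤ π.period) (ha : π.IsCenter a) {i j : Fin π.period}
    (hij : π.CellCovers a i j) : cell a j ⊆ π.linearMap '' cell a i := by
  have := intermediate_value_uIcc (π.continuousOn_linearMap.mono (ha.cell_subset_Icc i))
  rw [π.linearMap_natCast h2] at this
  exact hij.trans this

/-- The cell of `i` is mapped affinely and injectively. -/
theorem exists_expansion (h2 : 2 ≤ π.period) (ha : π.IsCenter a) (j : Fin π.period) :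
    ∃ m : ℝ, m ≠ 0 ∧
      ∀ t ∈ cell a j, π.linearMap t = (π.perm j : ℕ) + m * (t - (j : ℕ)) := by
  obtain ⟨m, hm⟩ := ha.exists_affine j
  refine ⟨m, ?_, hm⟩
  rintro rfl
  apply ha.linearMap_innerEnd_ne h2 j
  rw [hm _ right_mem_uIcc]
  ring

theorem linearMap_mem_uIcc (ha : π.IsCenter a) {j : Fin π.period} {t : ℝ} (ht : t ∈ cell a j) :
    π.linearMap t ∈ uIcc ((π.perm j : ℕ) : ℝ) (π.linearMap (innerEnd a j)) := by
  obtain ⟨m, hm⟩ := ha.exists_affine j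
  rw [hm t ht, hm _ right_mem_uIcc, mem_uIcc]
  rw [cell, mem_uIcc] at ht
  rcases le_total 0 m with h | h <;> rcases ht with ⟨h1, h3⟩ | ⟨h1, h3⟩
  · left; constructor <;> nlinarith
  · right; constructor <;> nlinarith
  · right; constructor <;> nlinarith
  · left; constructor <;> nlinarith

theorem fixed_iff (ha : π.IsCenter a) {j : Fin π.period} {t : ℝ} (ht : t ∈ cell a j) :
    π.linearMap t = t ↔ t = a := by
  constructor
  · intro h
    by_contra hne
    have := ha.lt_linearMap ht
    rcases lt_or_gt_of_ne hne with h' | h'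
    · exact (this.1 h').ne' h
    · exact (this.2 h').ne h
  · rintro rfl; exact ha.fixed

theorem lt_linearMap_iff (ha : π.IsCenter a) {j : Fin π.period} {t : ℝ} (ht : t ∈ cell a j)
    (hne : t ≠ a) :
    (t < π.linearMap t ↔ ((j : ℕ) : ℝ) < a) ∧ (π.linearMap t < t ↔ a < ((j : ℕ) : ℝ)) := by
  have hs := ha.mem_cell_lt_iff ht hne
  have hf := ha.lt_linearMap ht
  have hj := ha.ne j
  rcases lt_or_gt_of_ne hne with h | h
  · have h1 := hs.2 h
    exact ⟨⟨fun _ => h1, fun _ => hf.1 h⟩, ⟨fun h3 => absurd h3 (hf.1 h).not_gt,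
      fun h3 => absurd h3 h1.not_gt⟩⟩
  · have h1 : a < ((j : ℕ) : ℝ) := lt_of_le_of_ne (not_lt.1 fun h3 => (hs.1 h3).not_gt h) hj.symm
    exact ⟨⟨fun h3 => absurd h3 (hf.2 h).not_gt, fun h3 => absurd h3 h1.not_gt⟩,
      ⟨fun _ => h1, fun _ => hf.2 h⟩⟩

/-- If two cells containing the center are joined by a covering, they lie on different sides. -/
theorem crossing_of_center_mem (ha : π.IsCenter a) {i j : Fin π.period}
    (hi : a ∈ cell a i) (hij : π.CellCovers a i j) :
    ((i : ℕ) : ℝ) < a ↔ a < ((j : ℕ) : ℝ) := by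
  have hinner : innerEnd a i = a := by
    by_contra hne
    have := ha.inCell_iff.2 ⟨hi, Ne.symm hne⟩
    rcases this with ⟨-, -, h⟩ | ⟨-, -, h⟩ <;> exact lt_irrefl _ h
  -- The image of the cell runs from `π.perm i` to `a`. Since `i` moves by at least one and `a` is
  -- within distance one of it, `π.perm i` has passed to the other side.
  have hj : ((j : ℕ) : ℝ) ∈ uIcc ((π.perm i : ℕ) : ℝ) a := by
    have := hij (natCast_mem_cell j)
    rwa [hinner, ha.fixed] at this
  rw [mem_uIcc] at hj
  have hne := ha.ne j
  rcases ha.mem_cell_iff.1 hi with ⟨h, -, h3, -⟩ | ⟨h, h3, -⟩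
  · have h4 : ((i : ℕ) : ℝ) + 1 ≤ (π.perm i : ℕ) := by exact_mod_cast ha.lt_perm i h
    refine ⟨fun _ => ?_, fun _ => h⟩
    rcases hj with ⟨h5, h6⟩ | ⟨h5, h6⟩
    · exact absurd (le_antisymm (by linarith) (by linarith)) hne
    · exact lt_of_le_of_ne h5 hne.symm
  · have h4 : ((π.perm i : ℕ) : ℝ) + 1 ≤ (i : ℕ) := by exact_mod_cast ha.perm_lt i h
    refine ⟨fun h5 => absurd h5 h.not_gt, fun h5 => ?_⟩
    rcases hj with ⟨h6, h7⟩ | ⟨h6, h7⟩ <;> linarith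

/-- A periodic point follows the loop, and its changes from plus to minus are the crossings of the
loop, so minimality applies. The exception is that this point is `a` itself: then the loop
alternates between the two sides, and its proportion of crossings is 1/2, which is at least p/n
because 2p ≤ n. -/
theorem loop_bound (h2 : 2 ≤ π.period) (hmin : π.IsMinimal) (ha : π.IsCenter a)
    (c : ℕ → Fin π.period) (L : ℕ) (hL : 0 < L)
    (hc : ∀ i < L, π.CellCovers a (c i) (c (i + 1))) (hcL : c L = c 0) :
    π.overRotationPair.1 * L ≤
      π.period * ∑ i ∈ Finset.range L, crossing a (c i) (c (i + 1)) := by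
  set f := π.linearMap with hf
  have hcont := π.continuousOn_linearMap
  obtain ⟨x, hx, hmem⟩ := exists_periodic_of_covering (f := f)
    (l := fun i => ((c i : ℕ) : ℝ) ⊓ innerEnd a (c i))
    (r := fun i => ((c i : ℕ) : ℝ) ⊔ innerEnd a (c i)) (L := L) (fun i => inf_le_sup)
    (fun i => hcont.mono (ha.cell_subset_Icc (c i)))
    (fun i hi => ha.cell_subset_image h2 (hc i hi)) (by simp only [hcL]) (by simp only [hcL])
  have hmem' : ∀ i ≤ L, f^[i] x ∈ cell a (c i) := hmem
  have hx0 : x ∈ cell a (c 0) := hmem' 0 (Nat.zero_le _)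
  by_cases hxa : x = a
  · have hfix : ∀ i, f^[i] x = a := fun i => by
      rw [hxa]; exact Function.iterate_fixed ha.fixed i
    have hcross : ∀ i < L, (((c i : ℕ) : ℝ) < a ↔ a < ((c (i + 1) : ℕ) : ℝ)) := fun i hi =>
      ha.crossing_of_center_mem (hfix i ▸ hmem' i hi.le) (hc i hi)
    let b : ℕ → ℕ := fun i => if ((c i : ℕ) : ℝ) < a then 1 else 0
    have hb : ∀ i < L, crossing a (c i) (c (i + 1)) = b i := by
      intro i hi
      simp only [crossing, b, ← hcross i hi, and_self]
    have hb1 : ∀ i < L, b i + b (i + 1) = 1 := by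
      intro i hi
      have := hcross i hi
      have hne := ha.ne (c (i + 1))
      by_cases h : ((c i : ℕ) : ℝ) < a
      · simp [b, h, (this.1 h).not_gt]
      · have h' : ((c (i + 1) : ℕ) : ℝ) < a := lt_of_le_of_ne (not_lt.1 (mt this.2 h)) hne
        simp [b, h, h']
    have hshift : ∑ i ∈ Finset.range L, b (i + 1) = ∑ i ∈ Finset.range L, b i := by
      have h3 := Finset.sum_range_succ b L
      have h4 := Finset.sum_range_succ' b L
      have h5 : b L = b 0 := by simp only [b, hcL]
      omega
    have hsum : ∑ i ∈ Finset.range L, b i + ∑ i ∈ Finset.range L, b (i + 1) = L := by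
      rw [← Finset.sum_add_distrib, Finset.sum_congr rfl fun i hi =>
        hb1 i (Finset.mem_range.1 hi)]
      simp
    rw [Finset.sum_congr rfl fun i hi => hb i (Finset.mem_range.1 hi)]
    rw [hshift] at hsum
    have h6 := Nat.mul_le_mul_right L π.two_mul_overRotationPair_fst_le
    have h7 : π.period * L = 2 * (π.period * ∑ i ∈ Finset.range L, b i) := by
      conv_lhs => rw [← hsum]
      ring
    rw [mul_assoc] at h6
    exact Nat.le_of_mul_le_mul_left (h6.trans_eq h7) two_pos
  · have hne : ∀ i ≤ L, f^[i] x ≠ a := by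
      intro i hi h
      apply hxa
      rw [← hx, ← Nat.sub_add_cancel hi, Function.iterate_add_apply, h]
      exact Function.iterate_fixed ha.fixed _
    have hbound := le_card_sign_changes (π.mapsTo_linearMap h2) hmin (ha.cell_subset_Icc _ hx0)
      hL hx (fun h => hxa ((ha.fixed_iff hx0).1 h))
    refine hbound.trans_eq ?_
    congr 1
    refine Finset.sum_congr rfl fun s hs => ?_
    have hs' := Finset.mem_range.1 hs
    have e1 := (ha.lt_linearMap_iff (hmem' s hs'.le) (hne s hs'.le)).1
    have e2 := (ha.lt_linearMap_iff (hmem' (s + 1) hs') (hne (s + 1) hs')).2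
    rw [← hf, ← Function.iterate_succ_apply' f] at e1 e2
    simp only [crossing, ← e1, ← e2]
    rfl

/-- The first entry of the over-rotation pair of a cycle counts the passages from the left to the
right of the center. -/
theorem sum_crossing (ha : π.IsCenter a) {θ : Pattern} (hθ : 2 ≤ θ.period)
    {y : Fin θ.period → ℝ} (hy : StrictMono y) (hf : ∀ i, π.linearMap (y i) = y (θ.perm i))
    {v : Fin θ.period → Fin π.period} (hv : ∀ i, y i ∈ cell a (v i)) :
    ∑ i, crossing a (v i) (v (θ.perm i)) = θ.overRotationPair.1 := by
  have hne : ∀ i, y i ≠ a := by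
    intro i h
    have := hf i
    rw [(ha.fixed_iff (hv i)).2 h] at this
    exact θ.perm_apply_ne hθ i (hy.injective this).symm
  rw [θ.overRotationPair_fst_eq hθ]
  refine Finset.sum_congr rfl fun i _ => ?_
  have e1 := (ha.lt_linearMap_iff (hv i) (hne i)).1
  have e2 := (ha.lt_linearMap_iff (hv (θ.perm i)) (hne (θ.perm i))).2
  rw [hf, hy.lt_iff_lt] at e1 e2
  simp only [crossing, ← e1, ← e2]

/-! ### Consequences of coprimality. -/

/-- If the over-rotation pair is coprime, each cell covers the cell of the image point. -/
theorem cellCovers_perm (h2 : 2 ≤ π.period) (hmin : π.IsMinimal)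
    (hcop : Nat.Coprime π.overRotationPair.1 π.period) (ha : π.IsCenter a) (j : Fin π.period) :
    π.CellCovers a j (π.perm j) := by
  let x₀ : Fin π.period := ⟨0, π.period_pos⟩
  -- The cycle itself is followed through cells containing its points. The walk starts at the
  -- leftmost point because that point lies in one cell only.
  obtain ⟨τ, hτ⟩ := exists_section (E := π.CellCovers a)
    (R := fun x j => ((x : ℕ) : ℝ) ∈ cell a j) x₀ (natCast_mem_cell x₀) (by
      intro j hj
      rcases ha.mem_cell_iff.1 hj with ⟨-, h, -⟩ | ⟨h, -, -, h'⟩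
      · have : (j : ℕ) ≤ 0 := by exact_mod_cast h
        exact Fin.ext (Nat.le_zero.1 this)
      · exact absurd (le_antisymm (by simpa [x₀] using ha.mem.1) h') (ha.ne x₀)) (by
      intro x j hx
      -- A cycle point in a cell is one of its ends. The next cell is then taken at `π.perm x`, in
      -- the direction of the image of the other end.
      have hends : ((x : ℕ) : ℝ) = (j : ℕ) ∨ ((x : ℕ) : ℝ) = innerEnd a j := by
        by_contra! hcon
        rcases ha.inCell_iff.2 ⟨hx, hcon.2⟩ with ⟨h3, h4, -⟩ | ⟨h3, h4, -⟩
        · have h5 : (x : ℕ) < j + 1 := by exact_mod_cast h4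
          have h6 : (j : ℕ) ≤ x := by exact_mod_cast h3
          exact hcon.1 (by rw [show (x : ℕ) = j by omega])
        · have h5 : ((j : ℕ) : ℝ) < (x : ℕ) + 1 := by linarith
          have h6 : (j : ℕ) < x + 1 := by exact_mod_cast h5
          have h7 : (x : ℕ) ≤ j := by exact_mod_cast h4
          exact hcon.1 (by rw [show (x : ℕ) = j by omega])
      rcases hends with h | h
      · have hxj : x = j := Fin.ext (by exact_mod_cast h)
        subst hxj
        exact ha.exists_cell_subset (ha.linearMap_mem_special h2 (ha.innerEnd_mem_special x)) _
          (ha.linearMap_innerEnd_ne h2 x)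
      · have hne : ((x : ℕ) : ℝ) ≠ (j : ℕ) := fun h' => ha.ne_innerEnd j (by rw [← h', h])
        obtain ⟨l, hl, hl'⟩ := ha.exists_cell_subset (natCast_mem_special (π.perm j)) (π.perm x)
          (by
            intro h'
            have : π.perm x = π.perm j := Fin.ext (by exact_mod_cast h')
            exact hne (by rw [π.perm.injective this]))
        refine ⟨l, ?_, hl'⟩
        rw [CellCovers, ← h, π.linearMap_natCast h2, uIcc_comm]
        exact hl)
  have hw : ∑ x, crossing a (τ x) (τ (π.perm x)) = π.overRotationPair.1 :=
    ha.sum_crossing h2 (y := fun i => ((i : ℕ) : ℝ)) (fun _ _ h => Nat.cast_lt.2 h)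
      (π.linearMap_natCast h2) (fun i => (hτ i).1)
  have hinj : Function.Injective τ :=
    injective_of_loop_bound hcop (ha.loop_bound h2 hmin) (fun x => (hτ x).2) hw
  -- `τ x` is `x` or its outer neighbour. The extreme point has no outer neighbour, and going
  -- inwards the outer neighbour is already a value of `τ`, so injectivity excludes it.
  have hleft : ∀ (k : ℕ) (x : Fin π.period), (x : ℕ) = k → ((x : ℕ) : ℝ) < a → τ x = x := by
    intro k
    induction k with
    | zero =>
      intro x hx hxa
      rcases ha.mem_cell_iff.1 (hτ x).1 with ⟨h3, h4, h5, h6⟩ | ⟨h3, h4, h5, h6⟩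
      · have h7 : (τ x : ℕ) ≤ x := by exact_mod_cast h4
        exact Fin.ext (by omega)
      · linarith
    | succ k ih =>
      intro x hx hxa
      rcases ha.mem_cell_iff.1 (hτ x).1 with ⟨h3, h4, h5, h6⟩ | ⟨h3, h4, h5, h6⟩
      · have h7 : (τ x : ℕ) ≤ x := by exact_mod_cast h4
        have h8 : (x : ℕ) ≤ τ x + 1 := by exact_mod_cast h5
        rcases h7.lt_or_eq with h9 | h9
        · have h10 := ih (τ x) (by omega) h3
          exact absurd (hinj h10) (by intro h; rw [h] at h9; exact lt_irrefl _ h9)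
        · exact Fin.ext h9
      · linarith
  have hright : ∀ (k : ℕ) (x : Fin π.period), (x : ℕ) + k + 1 = π.period →
      a < ((x : ℕ) : ℝ) → τ x = x := by
    intro k
    induction k with
    | zero =>
      intro x hx hxa
      rcases ha.mem_cell_iff.1 (hτ x).1 with ⟨h3, h4, h5, h6⟩ | ⟨h3, h4, h5, h6⟩
      · linarith
      · have h7 : (x : ℕ) ≤ τ x := by exact_mod_cast h5
        exact Fin.ext (by omega)
    | succ k ih =>
      intro x hx hxa
      rcases ha.mem_cell_iff.1 (hτ x).1 with ⟨h3, h4, h5, h6⟩ | ⟨h3, h4, h5, h6⟩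
      · linarith
      · have h7 : (x : ℕ) ≤ τ x := by exact_mod_cast h5
        have h8' : ((τ x : ℕ) : ℝ) ≤ (x : ℕ) + 1 := by linarith
        have h8 : (τ x : ℕ) ≤ x + 1 := by exact_mod_cast h8'
        rcases h7.lt_or_eq with h9 | h9
        · have h10 := ih (τ x) (by omega) h3
          exact absurd (hinj h10) (by intro h; rw [h] at h9; exact lt_irrefl _ h9)
        · exact Fin.ext h9.symm
  have hid : ∀ x, τ x = x := by
    intro x
    rcases lt_or_gt_of_ne (ha.ne x) with h | h
    · exact hleft x x rfl h
    · exact hright (π.period - x - 1) x (by omega) h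
  have := (hτ j).2
  rwa [hid, hid] at this

/-- Under the coprimality assumption, a cycle of the `P`-linear map with the over-rotation number
of `P` has the pattern of `P`. -/
theorem eq_of_exhibits (h2 : 2 ≤ π.period) (hmin : π.IsMinimal)
    (hcop : Nat.Coprime π.overRotationPair.1 π.period) (ha : π.IsCenter a) {θ : Pattern}
    (hθ : 2 ≤ θ.period)
    (hrho : π.period * θ.overRotationPair.1 = π.overRotationPair.1 * θ.period)
    (hex : Exhibits π.linearMap (Icc 0 ((π.period : ℝ) - 1)) θ) : θ = π := by
  obtain ⟨y, hy, hyS, hf⟩ := hex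
  have hya : ∀ i, y i ≠ a := by
    intro i h
    have := hf i
    rw [h, ha.fixed, ← h] at this
    exact θ.perm_apply_ne hθ i (hy.injective this).symm
  choose v hv using fun i => exists_inCell h2 (hyS i) (hya i)
  have hvc : ∀ i, y i ∈ cell a (v i) := fun i => (ha.inCell_iff.1 (hv i)).1
  choose m hm0 hm using ha.exists_expansion h2
  have hF := ha.cellCovers_perm h2 hmin hcop
  have hvnat : ∀ (i : Fin θ.period) (j : Fin π.period), y i = ((j : ℕ) : ℝ) → v i = j := by
    intro i j h
    have h3 := hv i
    rw [h] at h3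
    have h4 : InCell a j ((j : ℕ) : ℝ) := ha.inCell_iff.2 ⟨natCast_mem_cell j, ha.ne_innerEnd j⟩
    exact le_antisymm (inCell_mono h3 h4 le_rfl) (inCell_mono h4 h3 le_rfl)
  -- A point of the cycle that is not the outer end of its cell has its image strictly between the
  -- images of the two ends, so the whole next cell is covered. At an outer end this fails, and
  -- `cellCovers_perm` is needed.
  have hedge : ∀ i, π.CellCovers a (v i) (v (θ.perm i)) := by
    intro i
    by_cases h : y i = ((v i : ℕ) : ℝ)
    · have h3 : y (θ.perm i) = ((π.perm (v i) : ℕ) : ℝ) := by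
        rw [← hf, h, π.linearMap_natCast h2]
      rw [hvnat _ _ h3]
      exact hF (v i)
    · have h3 := hm (v i) _ (hvc i)
      have h4 := hm (v i) (innerEnd a (v i)) right_mem_uIcc
      refine ha.cell_subset_of_inCell (natCast_mem_special _)
        (ha.linearMap_mem_special h2 (ha.innerEnd_mem_special _)) (hv (θ.perm i)) ?_ ?_ ?_
      · rw [← hf]; exact ha.linearMap_mem_uIcc (hvc i)
      · rw [← hf, h3]
        intro h5
        have h6 : m (v i) * (y i - (v i : ℕ)) = 0 := by linarith
        rcases mul_eq_zero.1 h6 with h7 | h7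
        · exact hm0 _ h7
        · exact h (sub_eq_zero.1 h7)
      · rw [← hf, h3, h4]
        intro h5
        have h6 : m (v i) * (y i - innerEnd a (v i)) = 0 := by linarith
        rcases mul_eq_zero.1 h6 with h7 | h7
        · exact hm0 _ h7
        · exact (ha.inCell_iff.1 (hv i)).2 (sub_eq_zero.1 h7)
  have hwπ : ∑ x, crossing a x (π.perm x) = π.overRotationPair.1 :=
    ha.sum_crossing h2 (y := fun i => ((i : ℕ) : ℝ)) (v := id) (fun _ _ h => Nat.cast_lt.2 h)
      (π.linearMap_natCast h2) natCast_mem_cell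
  obtain ⟨h, hh⟩ := exists_strict_potential hcop ⟨0, π.period_pos⟩ (ha.loop_bound h2 hmin) hF hwπ
  have hsemi : ∀ i, v (θ.perm i) = π.perm (v i) := by
    have hnonneg : ∀ i ∈ Finset.univ, (0 : ℤ) ≤ π.period * crossing a (v i) (v (θ.perm i)) -
        π.overRotationPair.1 - (h (v (θ.perm i)) - h (v i)) := fun i _ =>
      sub_nonneg.2 (hh _ _ (hedge i)).1
    -- The potential cancels around the cycle and the rest vanishes by equality of the over-rotation
    -- numbers; nonnegative slacks with sum zero are all zero, so every edge is tight.
    have hzero : ∑ i, ((π.period * crossing a (v i) (v (θ.perm i)) : ℤ) -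
        π.overRotationPair.1 - (h (v (θ.perm i)) - h (v i))) = 0 := by
      rw [Finset.sum_sub_distrib, Finset.sum_sub_distrib, Finset.sum_sub_distrib,
        ← Finset.mul_sum, Equiv.sum_comp θ.perm (fun i => h (v i))]
      have h3 : (∑ i, (crossing a (v i) (v (θ.perm i)) : ℤ)) = θ.overRotationPair.1 := by
        exact_mod_cast ha.sum_crossing hθ hy hf hvc
      have h4 : (π.period * θ.overRotationPair.1 : ℤ) = π.overRotationPair.1 * θ.period := by
        exact_mod_cast hrho
      rw [h3, h4]
      simp [mul_comm]
    intro i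
    have := (Finset.sum_eq_zero_iff_of_nonneg hnonneg).1 hzero i (Finset.mem_univ i)
    exact (hh _ _ (hedge i)).2 (sub_eq_zero.1 this).symm
  have hsemi' : ∀ t i, v ((θ.perm ^ t) i) = (π.perm ^ t) (v i) := by
    intro t i
    induction t with
    | zero => rfl
    | succ t ih => rw [pow_succ', pow_succ', Equiv.Perm.mul_apply, Equiv.Perm.mul_apply, hsemi, ih]
  -- Distance to the outer end of the cell; outer ends are mapped to outer ends, so each step
  -- multiplies it by the slope.
  let D : Fin θ.period → ℝ := fun i => |y i - (v i : ℕ)|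
  have hD : ∀ i, D (θ.perm i) = |m (v i)| * D i := by
    intro i
    simp only [D]
    rw [hsemi, ← hf, hm _ _ (hvc i), add_sub_cancel_left, abs_mul]
  have hDt : ∀ t i, D ((θ.perm ^ t) i) =
      (∏ s ∈ Finset.range t, |m ((π.perm ^ s) (v i))|) * D i := by
    intro t i
    induction t with
    | zero => simp
    | succ t ih =>
      rw [pow_succ', Equiv.Perm.mul_apply, hD, ih, hsemi', Finset.prod_range_succ]
      ring
  have hret : ∀ i, (θ.perm ^ π.period) i = i := by
    intro i
    set Λ := ∏ s ∈ Finset.range π.period, |m ((π.perm ^ s) (v i))| with hΛ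
    have hΛ0 : 0 ≤ Λ := Finset.prod_nonneg fun _ _ => abs_nonneg _
    have hvn : ∀ k, v ((θ.perm ^ (π.period * k)) i) = v i := fun k => by
      rw [hsemi', π.pow_apply_eq_iff]; exact dvd_mul_right _ _
    have hDk : ∀ k, D ((θ.perm ^ (π.period * k)) i) = Λ ^ k * D i := by
      intro k
      induction k with
      | zero => simp
      | succ k ih =>
        rw [Nat.mul_succ, add_comm, pow_add, Equiv.Perm.mul_apply, hDt, hvn, ih, pow_succ]
        ring
    have hDi : D ((θ.perm ^ π.period) i) = D i := by
      -- After `π.period * θ.period` steps the point is back, so `Λ ^ θ.period` fixes `D i`; hence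
      -- `D i = 0` or `Λ = 1`.
      have h3 := hDk θ.period
      rw [(θ.pow_apply_eq_iff i _).2 (dvd_mul_left _ _)] at h3
      have h4 := hDk 1
      rw [mul_one, pow_one] at h4
      rw [h4]
      rcases eq_or_ne (D i) 0 with h5 | h5
      · rw [h5, mul_zero]
      · have h6 : Λ ^ θ.period = 1 := (mul_eq_right₀ h5).1 h3.symm
        rw [(pow_eq_one_iff_of_nonneg hΛ0 (by omega)).1 h6, one_mul]
    have hvi : v ((θ.perm ^ π.period) i) = v i := by simpa using hvn 1
    apply hy.injective
    have h3 := hv ((θ.perm ^ π.period) i)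
    rw [hvi] at h3
    refine eq_of_inCell_of_dist_eq h3 (hv i) ?_
    simpa only [D, hvi] using hDi
  have i₀ : Fin θ.period := ⟨0, θ.period_pos⟩
  have hper : θ.period = π.period := by
    apply Nat.dvd_antisymm
    · exact (θ.pow_apply_eq_iff i₀ _).1 (hret i₀)
    · rw [← π.pow_apply_eq_iff (v i₀), ← hsemi', (θ.pow_apply_eq_iff i₀ _).2 dvd_rfl]
  refine eq_of_strictMono_semiconj hper (Monotone.strictMono_of_injective ?_ ?_) hsemi
  · exact fun i j hij => inCell_mono (hv i) (hv j) (hy.monotone hij)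
  · intro i j hij
    obtain ⟨s, hs, rfl⟩ := θ.exists_pow_eq i j
    rw [hsemi', eq_comm, π.pow_apply_eq_iff, ← hper] at hij
    rw [Nat.eq_zero_of_dvd_of_lt hij hs]
    rfl

end IsCenter

end Pattern

end OverRotation

/-- If a pattern `π` (not that of a fixed point) is not an over-twist and `r_π = ρ(π)`, then the
over-rotation pair of `π` is not coprime. -/
theorem corollaryc (π : OverRotation.Pattern) (hperiod : 2 ≤ π.period)
    (hnot : ¬ π.IsOverTwist) (hr : π.leftEndpoint = π.overRotationNumber) :
    ¬ Nat.Coprime π.overRotationPair.1 π.overRotationPair.2 := by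
  intro hcop
  have hcop' : Nat.Coprime π.overRotationPair.1 π.period := hcop
  have hmin := π.isMinimal_of_leftEndpoint_eq hr
  have hp : 0 < π.overRotationPair.1 := by
    rw [Nat.pos_iff_ne_zero]
    intro h
    -- The value 0 is coprime only to 1, and the period is at least 2.
    rw [h, Nat.coprime_zero_left] at hcop'
    omega
  obtain ⟨a, ha⟩ := hmin.exists_isCenter hperiod hp
  refine hnot ⟨hperiod, fun θ hθ hrho hforces => ?_⟩
  have hn : (π.period : ℝ) ≠ 0 := Nat.cast_ne_zero.2 π.period_pos.ne'
  have hq : (θ.period : ℝ) ≠ 0 := Nat.cast_ne_zero.2 θ.period_pos.ne'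
  have hrho' : (θ.overRotationPair.1 : ℝ) / θ.period = (π.overRotationPair.1 : ℝ) / π.period :=
    hrho
  rw [div_eq_div_iff hq hn] at hrho'
  -- Forcing is applied to a single map, the `P`-linear one.
  refine ha.eq_of_exhibits hperiod hmin hcop' hθ ?_
    (hforces _ _ _ π.continuousOn_linearMap (π.mapsTo_linearMap hperiod)
      (π.exhibits_linearMap hperiod))
  rw [mul_comm]
  exact_mod_cast hrho'
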